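/- For a convex body $K\subset\mathbb{R}^m$ (a compact convex set with nonempty interior), a normal of $K$ is a half-line that starts at a boundary point $q$ of $K$, is perpendicular to a supporting hyperplane $H$ of $K$ at $q$, and points to the side of $H$ containing $K$. For $p\in K$ let $n(K,p)\in\{0,1,2,\dots\}\cup\{\infty\}$ be the number of normals of $K$ passing through $p$, and let \[ n(K)=\frac{1}{\operatorname{vol}(K)}\int_{K} n(K,p)\,dp . \] Let $P\subset\mathbb{R}^m$ be a convex polytope with nonempty interior that is symmetric about the origin, and suppose that $n(P)=3^m-1$. Then: 1. $P$ is a zonotope, i.e. the Minkowski sum of finitely many closed segments. 2. If $m=3$, then no angle of a two-dimensional face of $P$ is acute, and $P$ has a two-dimensional face that is a rectangle. Moreover, the claim that the centrally symmetric convex polytopes $P\subset\mathbb{R}^m$ with $n(P)=3^m-1$ are exactly those inscribed in a sphere is false: there is a convex polytope $P\subset\mathbb{R}^3$ with nonempty interior, symmetric about the origin and inscribed in a sphere (all its vertices lie on one sphere), with $n(P)\neq 3^3-1$. -/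

import Mathlib

open scoped Pointwise

noncomputable section

/-- Convex bodies in Euclidean `m`-space: compact convex sets with nonempty interior. -/
structure IsConvexBody {m : ℕ} (K : Set (EuclideanSpace ℝ (Fin m))) : Prop where
  isCompact : IsCompact K
  convex : Convex ℝ K
  interior_nonempty : (interior K).Nonempty

/-- Symmetry with respect to the origin `o`. -/
def IsOSymmetric {m : ℕ} (K : Set (EuclideanSpace ℝ (Fin m))) : Prop :=
  ∀ x ∈ K, -x ∈ K

/-- Convex polytopes: convex hulls of finitely many points. -/
def IsConvexPolytope {m : ℕ} (P : Set (EuclideanSpace ℝ (Fin m))) : Prop :=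
  ∃ V : Finset (EuclideanSpace ℝ (Fin m)), P = convexHull ℝ (V : Set (EuclideanSpace ℝ (Fin m)))

/-- `o`-symmetric convex polytopes with nonempty interior. -/
structure IsOSymmetricPolytope {m : ℕ} (P : Set (EuclideanSpace ℝ (Fin m))) : Prop where
  isConvexBody : IsConvexBody P
  isOSymmetric : IsOSymmetric P
  isConvexPolytope : IsConvexPolytope P

/-- The normals of `K`. A normal is a half-line that starts at a boundary point `q` of `K` and is
perpendicular to a supporting hyperplane of `K` at `q`, pointing to the side of `K`. It is recorded
by its starting point `q` and its unit direction vector `u`: the hyperplane through `q`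
orthogonal to `u` supports `K`. -/
def normals {m : ℕ} (K : Set (EuclideanSpace ℝ (Fin m))) :
    Set (EuclideanSpace ℝ (Fin m) × EuclideanSpace ℝ (Fin m)) :=
  {N | N.1 ∈ frontier K ∧ ‖N.2‖ = 1 ∧ ∀ x ∈ K, 0 ≤ inner ℝ N.2 (x - N.1)}

/-- `n(K, p)`: the number (possibly infinite) of the normals of `K` passing through `p`. -/
def numNormals {m : ℕ} (K : Set (EuclideanSpace ℝ (Fin m))) (p : EuclideanSpace ℝ (Fin m)) : ℕ∞ :=
  {N ∈ normals K | ∃ t : ℝ, 0 ≤ t ∧ p = N.1 + t • N.2}.encard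

/-- `I(K)`: the integral over `K` of `n(K, p)` with respect to Lebesgue measure. -/
def totalNormals {m : ℕ} (K : Set (EuclideanSpace ℝ (Fin m))) : ENNReal :=
  ∫⁻ p in K, (numNormals K p : ENNReal)

/-- `n(K) = I(K) / vol(K)`: the mean number of normals through a uniformly random point of `K`. -/
def meanNormals {m : ℕ} (K : Set (EuclideanSpace ℝ (Fin m))) : ENNReal :=
  totalNormals K / MeasureTheory.volume K

/-- Zonotopes: Minkowski sums of finitely many closed segments. -/
def IsZonotope {m : ℕ} (P : Set (EuclideanSpace ℝ (Fin m))) : Prop :=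
  ∃ (k : ℕ) (a b : Fin k → EuclideanSpace ℝ (Fin m)), P = ∑ i, segment ℝ (a i) (b i)

/-- `F` is a nonempty face of the polytope `P`, of dimension `k`: a set of maximizers
over `P` of a linear functional. -/
def IsFaceOfDim {m : ℕ} (P : Set (EuclideanSpace ℝ (Fin m))) (k : ℕ)
    (F : Set (EuclideanSpace ℝ (Fin m))) : Prop :=
  F.Nonempty ∧ IsExposed ℝ P F ∧ Module.finrank ℝ (vectorSpan ℝ F) = k

/-- `[x, y]` is an edge of `P`. -/
def IsEdge {m : ℕ} (P : Set (EuclideanSpace ℝ (Fin m))) (x y : EuclideanSpace ℝ (Fin m)) : Prop :=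
  IsFaceOfDim P 1 (segment ℝ x y)

/-- The angles of the polygon `F`: the angle at `x` between two distinct edges
`[x, y]` and `[x, z]` of `F`. -/
def polygonAngles {m : ℕ} (F : Set (EuclideanSpace ℝ (Fin m))) : Set ℝ :=
  {θ | ∃ x y z : EuclideanSpace ℝ (Fin m),
    IsEdge F x y ∧ IsEdge F x z ∧ y ≠ z ∧ θ = EuclideanGeometry.angle y x z}

/-- Nondegenerate rectangles. -/
def IsRectangle {m : ℕ} (F : Set (EuclideanSpace ℝ (Fin m))) : Prop :=
  ∃ a u v : EuclideanSpace ℝ (Fin m), u ≠ 0 ∧ v ≠ 0 ∧ inner ℝ u v = 0 ∧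
    F = convexHull ℝ {a, a + u, a + u + v, a + v}

/-- The polytope `P` is inscribed in a sphere: all its vertices lie on one sphere. -/
def IsInscribedInSphere {m : ℕ} (P : Set (EuclideanSpace ℝ (Fin m))) : Prop :=
  ∃ (c : EuclideanSpace ℝ (Fin m)) (r : ℝ), 0 < r ∧ P.extremePoints ℝ ⊆ Metric.sphere c r

end

/-! Let `π` be the nearest-point map of `P` and `R x = 2 π x - x`. A normal with foot `q` through a
point `p` off the boundary corresponds to `x = 2q - p`, which lies outside `P` and satisfies `π x =
q`, `R x = p`. As `R` is 1-Lipschitz and injective on each of finitely many pieces, the integral of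
`n(P, ·)` over `P` is at most the volume of `{x ∉ P | R x ∈ P}` (`totalNormals_le`). For such `x`,
symmetry and the identity `x/3 = (2/3) π x + (1/3)(-R x)` give `x ∈ 3P`, so the bound is at most
`vol (3P \ P) = (3^m - 1) vol P`. Equality forces `R` to map `3P` into `P`
(`reflection_mem_of_meanNormals_eq`).

For `x` in a face `F`, the same identity writes `x` as a convex combination of `π (3x)` and `-R
(3x)`, so both lie in `F`. Hence `F` is symmetric about the foot `c` of the perpendicular from the
origin, and `c` is orthogonal to `F` (`IsMetricProjection.exists_center`). A polytope with symmetric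
faces is a zonotope: an edge is a Minkowski summand, and splitting it off leaves a polytope
generated by fewer points (`HasSymmetricFaces.exists_eq_sum_segment`).

Applied to edges, the symmetry says that both ends have equal norm. This excludes acute angles in
polygonal faces (`inner_nonpos_of_edges`) and makes parallelogram faces rectangles. In space a
parallelogram face exists by the Sylvester–Gallai theorem, applied to the directions of the segments
as points of a projective plane. The regular octahedron is inscribed in a sphere, but its `R` sends
a point of `3P` outside `P`. -/

/-! ### Nearest-point maps and reflection in the nearest point. -/

section MetricProjection

variable {E : Type*} [NormedAddCommGroup E] [InnerProductSpace ℝ E]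

/-- `π` is the metric projection onto `K`, in its variational characterization. -/
structure IsMetricProjection (K : Set E) (π : E → E) : Prop where
  mem : ∀ x, π x ∈ K
  inner_le : ∀ x, ∀ w ∈ K, inner ℝ (x - π x) (w - π x) ≤ 0

theorem exists_isMetricProjection {K : Set E} (hK : IsCompact K) (hc : Convex ℝ K)
    (hne : K.Nonempty) : ∃ π : E → E, IsMetricProjection K π := by
  have h : ∀ x : E, ∃ q ∈ K, ∀ w ∈ K, inner ℝ (x - q) (w - q) ≤ 0 := by
    intro x
    obtain ⟨q, hq, h⟩ := exists_norm_eq_iInf_of_complete_convex hne hK.isComplete hc x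
    exact ⟨q, hq, (norm_eq_iInf_iff_real_inner_le_zero hc hq).1 h⟩
  choose π h1 h2 using h
  exact ⟨π, h1, h2⟩

namespace IsMetricProjection

variable {K : Set E} {π : E → E}

theorem eq_of_inner_le (hπ : IsMetricProjection K π) {x q : E} (hq : q ∈ K)
    (h : ∀ w ∈ K, inner ℝ (x - q) (w - q) ≤ 0) : π x = q := by
  have h1 := h _ (hπ.mem x)
  have h2 := hπ.inner_le x q hq
  have h3 : inner ℝ (π x - q) (π x - q) ≤ 0 := by
    have e : inner ℝ (π x - q) (π x - q)
        = inner ℝ (x - q) (π x - q) + inner ℝ (x - π x) (q - π x) := by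
      simp only [inner_sub_left, inner_sub_right, real_inner_comm]; ring
    linarith
  exact sub_eq_zero.1 (real_inner_self_nonpos.1 h3)

theorem eq_self (hπ : IsMetricProjection K π) {x : E} (hx : x ∈ K) : π x = x :=
  hπ.eq_of_inner_le hx (by simp)

theorem norm_sub_sq_le (hπ : IsMetricProjection K π) (x y : E) :
    ‖π x - π y‖ ^ 2 ≤ inner ℝ (π x - π y) (x - y) := by
  have h1 := hπ.inner_le x _ (hπ.mem y)
  have h2 := hπ.inner_le y _ (hπ.mem x)
  rw [← real_inner_self_eq_norm_sq]
  have e : inner ℝ (π x - π y) (π x - π y)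
      = inner ℝ (π x - π y) (x - y) + inner ℝ (x - π x) (π y - π x)
        + inner ℝ (y - π y) (π x - π y) := by
    simp only [inner_sub_left, inner_sub_right, real_inner_comm]; ring
  linarith

/-- Firm nonexpansiveness in disguise: for `a = π x - π y` and `d = x - y`, `‖2a - d‖² = ‖d‖² -
4(⟪a, d⟫ - ‖a‖²)`. -/
theorem lipschitzWith_reflection (hπ : IsMetricProjection K π) :
    LipschitzWith 1 (fun x => (2 : ℝ) • π x - x) := by
  refine LipschitzWith.of_dist_le_mul fun x y => ?_
  rw [NNReal.coe_one, one_mul, dist_eq_norm, dist_eq_norm]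
  refine le_of_sq_le_sq ?_ (norm_nonneg _)
  have e : (2 : ℝ) • π x - x - ((2 : ℝ) • π y - y) = (2 : ℝ) • (π x - π y) - (x - y) := by
    module
  rw [e, norm_sub_sq_real, norm_smul, real_inner_smul_left, mul_pow]
  have := hπ.norm_sub_sq_le x y
  norm_num
  linarith

theorem continuous (hπ : IsMetricProjection K π) : Continuous π := by
  have h : π = fun x => (2⁻¹ : ℝ) • (((2 : ℝ) • π x - x) + x) := by
    ext1 x; rw [sub_add_cancel, smul_smul]; norm_num
  rw [h]
  exact (hπ.lipschitzWith_reflection.continuous.add continuous_id).const_smul _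

/-- The reflection in the nearest point is injective on the set of points `x` for which the
hyperplane through `π x` orthogonal to `x - π x` contains a given set of vertices. -/
theorem eq_of_reflection_eq (hπ : IsMetricProjection K π) {V : Set E}
    (hV : K = convexHull ℝ V) {x y : E}
    (hW : ∀ v ∈ V, 0 ≤ inner ℝ (x - π x) (v - π x) ↔ 0 ≤ inner ℝ (y - π y) (v - π y))
    (h : (2 : ℝ) • π x - x = (2 : ℝ) • π y - y) : x = y := by
  -- `π y` is a convex combination of points of `V` on the hyperplane at `π y`; by `hW` these all
  -- lie on the nonnegative side of the hyperplane at `π x`.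
  have key : ∀ x y : E,
      (∀ v ∈ V, 0 ≤ inner ℝ (x - π x) (v - π x) ↔ 0 ≤ inner ℝ (y - π y) (v - π y)) →
      0 ≤ inner ℝ (x - π x) (π y - π x) := by
    intro x y hW
    set f : E → ℝ := fun v => inner ℝ (y - π y) (v - π y) with hf
    have hmem := hπ.mem y
    rw [hV, convexHull_eq] at hmem
    obtain ⟨ι, t, w, z, hw0, hw1, hz, hc⟩ := hmem
    have lin : ∀ a b : E, inner ℝ a (π y - b) = ∑ i ∈ t, w i * inner ℝ a (z i - b) := by
      intro a b
      rw [← hc, Finset.centerMass_eq_of_sum_1 _ _ hw1]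
      simp only [inner_sub_right, inner_sum, real_inner_smul_right, mul_sub,
        Finset.sum_sub_distrib, ← Finset.sum_mul, hw1, one_mul]
    have h0 := lin (y - π y) (π y)
    rw [sub_self, inner_zero_right] at h0
    have hle : ∀ i ∈ t, w i * inner ℝ (y - π y) (z i - π y) ≤ 0 := fun i hi =>
      mul_nonpos_of_nonneg_of_nonpos (hw0 i hi)
        (hπ.inner_le y _ (hV ▸ subset_convexHull ℝ V (hz i hi)))
    have heq := (Finset.sum_eq_zero_iff_of_nonpos hle).1 h0.symm
    rw [lin]
    refine Finset.sum_nonneg fun i hi => ?_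
    rcases mul_eq_zero.1 (heq i hi) with h | h
    · simp [h]
    · exact mul_nonneg (hw0 i hi) ((hW _ (hz i hi)).2 h.ge)
  have h1 := key x y hW
  have h2 := key y x (fun v hv => (hW v hv).symm)
  have e1 : y - π y = (x - π x) + (π y - π x) := by
    have : y = (2 : ℝ) • π y - (2 : ℝ) • π x + x := by
      rw [sub_add, h]; abel
    nth_rewrite 1 [this]; module
  have h3 : inner ℝ (π y - π x) (π y - π x) ≤ 0 := by
    have : π x - π y = -(π y - π x) := by abel
    rw [this, inner_neg_right, e1, inner_add_left] at h2
    linarith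
  have h4 : π y = π x := sub_eq_zero.1 (real_inner_self_nonpos.1 h3)
  rw [h4] at h
  exact sub_right_injective h

end IsMetricProjection

end MetricProjection

/-! ### Counting normals by volume, and the case of equality. -/

section Measure

open MeasureTheory

variable {m : ℕ}

/-- Lebesgue measure is a multiple of `m`-dimensional Hausdorff measure, so `s` need not be
measurable. -/
theorem LipschitzWith.volume_image_le {f : EuclideanSpace ℝ (Fin m) → EuclideanSpace ℝ (Fin m)}
    (hf : LipschitzWith 1 f) (s : Set (EuclideanSpace ℝ (Fin m))) :
    volume (f '' s) ≤ volume s := by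
  have h := hf.hausdorffMeasure_image_le (d := Module.finrank ℝ (EuclideanSpace ℝ (Fin m)))
    (by positivity) s
  have e := Measure.isAddLeftInvariant_eq_smul (volume : Measure (EuclideanSpace ℝ (Fin m)))
    (Measure.hausdorffMeasure (Module.finrank ℝ (EuclideanSpace ℝ (Fin m))))
  rw [e]
  simp only [Measure.smul_apply]
  simp only [ENNReal.coe_one, ENNReal.one_rpow, one_mul] at h
  gcongr

variable {P : Set (EuclideanSpace ℝ (Fin m))}
  {π : EuclideanSpace ℝ (Fin m) → EuclideanSpace ℝ (Fin m)}

open Classical in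
-- A normal through `p` with foot `q` yields the preimage `2q - p` of `p` under the reflection, and
-- by `eq_of_reflection_eq` the vertex pattern `W` of that preimage determines it. Staying off the
-- frontier excludes `t = 0`, where `p` and the foot would not determine the direction.
theorem numNormals_le_card (hπ : IsMetricProjection P π)
    {V : Finset (EuclideanSpace ℝ (Fin m))} (hV : P = convexHull ℝ (V : Set _))
    {p : EuclideanSpace ℝ (Fin m)} (hpf : p ∉ frontier P) :
    numNormals P p ≤ ∑ W ∈ V.powerset,
      ({p | ∃ x, x ∉ P ∧ V.filter (fun v => 0 ≤ inner ℝ (x - π x) (v - π x)) = W ∧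
        (2 : ℝ) • π x - x = p}.indicator (fun _ => (1 : ℕ∞)) p) := by
  set S := {N ∈ normals P | ∃ t : ℝ, 0 ≤ t ∧ p = N.1 + t • N.2} with hS
  set g : EuclideanSpace ℝ (Fin m) → Finset (EuclideanSpace ℝ (Fin m)) :=
    fun x => V.filter (fun v => 0 ≤ inner ℝ (x - π x) (v - π x)) with hg
  have hclosed : IsClosed P := by
    rw [hV]; exact (V.finite_toSet.isCompact_convexHull ℝ).isClosed
  have key : ∀ N ∈ S, π ((2 : ℝ) • N.1 - p) = N.1 ∧ (2 : ℝ) • N.1 - p ∉ P ∧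
      N.2 = ‖p - N.1‖⁻¹ • (p - N.1) := by
    rintro ⟨q, u⟩ ⟨⟨hq, hu, hsup⟩, t, ht, hpt⟩
    simp only at *
    have hqP : q ∈ P := hclosed.frontier_subset hq
    have h1 : π ((2 : ℝ) • q - p) = q := by
      refine hπ.eq_of_inner_le hqP fun w hw => ?_
      have : (2 : ℝ) • q - p - q = -(t • u) := by rw [hpt]; module
      rw [this, inner_neg_left, real_inner_smul_left]
      have := mul_nonneg ht (hsup w hw)
      linarith
    refine ⟨h1, fun hmem => ?_, ?_⟩
    · have h2 := hπ.eq_self hmem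
      rw [h1] at h2
      have : p = q := by
        have : p = (2 : ℝ) • q - ((2 : ℝ) • q - p) := by abel
        rw [this, ← h2]; module
      exact hpf (this ▸ hq)
    · have hpq : p - q = t • u := by rw [hpt]; abel
      have ht0 : t ≠ 0 := by
        rintro rfl
        rw [zero_smul, add_zero] at hpt
        exact hpf (hpt ▸ hq)
      rw [hpq, norm_smul, hu, mul_one, Real.norm_of_nonneg ht, smul_smul, inv_mul_cancel₀ ht0,
        one_smul]
  have hinj : Set.InjOn (fun N : EuclideanSpace ℝ (Fin m) × EuclideanSpace ℝ (Fin m) =>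
      g ((2 : ℝ) • N.1 - p)) S := by
    intro N hN N' hN' h
    obtain ⟨h1, h2, h3⟩ := key N hN
    obtain ⟨h1', h2', h3'⟩ := key N' hN'
    have hx : (2 : ℝ) • N.1 - p = (2 : ℝ) • N'.1 - p := by
      refine hπ.eq_of_reflection_eq hV (fun v hv => ?_) ?_
      · have := Finset.ext_iff.1 h v
        simpa [hg, Finset.mem_coe.1 hv] using this
      · rw [h1, h1']; abel
    have e1 : N.1 = N'.1 := by rw [← h1, ← h1', hx]
    exact Prod.ext e1 (by rw [h3, h3', e1])
  have hcount : (∑ W ∈ V.powerset,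
      ({p | ∃ x, x ∉ P ∧ V.filter (fun v => 0 ≤ inner ℝ (x - π x) (v - π x)) = W ∧
        (2 : ℝ) • π x - x = p}.indicator (fun _ => (1 : ℕ∞)) p)) =
      ((V.powerset.filter (fun W => ∃ x, x ∉ P ∧ g x = W ∧ (2 : ℝ) • π x - x = p)).card : ℕ∞) := by
    rw [Finset.card_filter]
    push_cast
    refine Finset.sum_congr rfl fun W _ => ?_
    simp only [Set.indicator_apply, Set.mem_ofPred_eq, hg]
  rw [hcount, numNormals, ← hinj.encard_image, ← Set.encard_coe_eq_coe_finsetCard]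
  refine Set.encard_le_encard ?_
  rintro _ ⟨N, hN, rfl⟩
  obtain ⟨h1, h2, h3⟩ := key N hN
  simp only [Finset.coe_filter, Finset.mem_powerset, Set.mem_ofPred_eq]
  refine ⟨Finset.filter_subset _ _, _, h2, rfl, ?_⟩
  rw [h1]; abel

theorem totalNormals_le (hπ : IsMetricProjection P π) (hP : IsConvexBody P)
    (hpoly : IsConvexPolytope P) :
    totalNormals P ≤ volume {x | x ∉ P ∧ (2 : ℝ) • π x - x ∈ P} := by
  classical
  obtain ⟨V, hV⟩ := hpoly
  set A : Finset (EuclideanSpace ℝ (Fin m)) → Set (EuclideanSpace ℝ (Fin m)) := fun W =>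
    {x | (x ∉ P ∧ (2 : ℝ) • π x - x ∈ P) ∧
      V.filter (fun v => 0 ≤ inner ℝ (x - π x) (v - π x)) = W} with hA
  set R : EuclideanSpace ℝ (Fin m) → EuclideanSpace ℝ (Fin m) := fun x => (2 : ℝ) • π x - x with hR
  have hclosed : IsClosed P := hP.isCompact.isClosed
  have hRc : Continuous R := hπ.lipschitzWith_reflection.continuous
  have hmeas : ∀ W, MeasurableSet (A W) := by
    intro W
    have h1 : MeasurableSet {x | x ∉ P ∧ (2 : ℝ) • π x - x ∈ P} :=
      hclosed.measurableSet.compl.inter (hclosed.preimage hRc).measurableSet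
    have h3 : MeasurableSet {x | V.filter (fun v => 0 ≤ inner ℝ (x - π x) (v - π x)) = W} := by
      by_cases hWV : W ⊆ V
      · have h2 : {x | V.filter (fun v => 0 ≤ inner ℝ (x - π x) (v - π x)) = W} =
            ⋂ v ∈ V, {x | 0 ≤ inner ℝ (x - π x) (v - π x) ↔ v ∈ W} := by
          ext x
          simp only [Finset.ext_iff, Finset.mem_filter, Set.mem_ofPred_eq, Set.mem_iInter]
          exact ⟨fun h v hv => by rw [← h v]; simp [hv],
            fun h v => ⟨fun hv => (h v hv.1).1 hv.2, fun hv => ⟨hWV hv, (h v (hWV hv)).2 hv⟩⟩⟩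
        rw [h2]
        refine Finset.measurableSet_biInter _ fun v _ => ?_
        have hc : IsClosed {x | 0 ≤ inner ℝ (x - π x) (v - π x)} :=
          isClosed_le continuous_const
            ((continuous_id.sub hπ.continuous).inner (continuous_const.sub hπ.continuous))
        by_cases hv : v ∈ W
        · simpa [hv] using hc.measurableSet
        · simpa [hv, Set.compl_def] using hc.measurableSet.compl
      · convert MeasurableSet.empty
        ext x
        simp only [Set.mem_ofPred_eq, Set.mem_empty_iff_false, iff_false]
        rintro rfl
        exact hWV (Finset.filter_subset _ _)
    exact h1.inter h3
  have hunion : {x | x ∉ P ∧ (2 : ℝ) • π x - x ∈ P} = ⋃ W ∈ V.powerset, A W := by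
    ext x
    simp [hA]
  have hdisj : Set.PairwiseDisjoint (V.powerset : Set (Finset (EuclideanSpace ℝ (Fin m)))) A := by
    intro W _ W' _ hne
    refine Set.disjoint_left.2 fun x hx hx' => hne ?_
    rw [← hx.2, ← hx'.2]
  rw [hunion, measure_biUnion_finset hdisj fun W _ => hmeas W]
  -- Measurable hulls have the same measure as the images and make measurability of the images
  -- unnecessary.
  set B : Finset (EuclideanSpace ℝ (Fin m)) → Set (EuclideanSpace ℝ (Fin m)) := fun W =>
    toMeasurable volume (R '' A W) with hB
  calc totalNormals P
      ≤ ∫⁻ p in P, ∑ W ∈ V.powerset, (B W).indicator (fun _ => (1 : ENNReal)) p := by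
        refine lintegral_mono_ae ?_
        have hfr : ∀ᵐ p ∂(volume.restrict P), p ∉ frontier P := by
          refine ae_restrict_of_ae ?_
          exact measure_eq_zero_iff_ae_notMem.1 (hP.convex.addHaar_frontier volume)
        filter_upwards [hfr, ae_restrict_mem hclosed.measurableSet] with p hpf hp
        have h := numNormals_le_card hπ hV hpf
        have h' : (numNormals P p : ENNReal) ≤ _ := ENat.toENNReal_le.2 h
        refine h'.trans ?_
        rw [← ENat.toENNRealRingHom_apply, map_sum]
        refine Finset.sum_le_sum fun W _ => ?_
        by_cases hmem : p ∈ {p | ∃ x, x ∉ P ∧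
            V.filter (fun v => 0 ≤ inner ℝ (x - π x) (v - π x)) = W ∧ (2 : ℝ) • π x - x = p}
        · rw [Set.indicator_of_mem hmem, Set.indicator_of_mem]
          · simp
          · obtain ⟨x, hx, hxW, hxp⟩ := hmem
            exact subset_toMeasurable _ _ ⟨x, ⟨⟨hx, by rwa [hxp]⟩, hxW⟩, hxp⟩
        · rw [Set.indicator_of_notMem hmem]
          simp
    _ ≤ ∫⁻ p, ∑ W ∈ V.powerset, (B W).indicator (fun _ => (1 : ENNReal)) p :=
        setLIntegral_le_lintegral _ _
    _ = ∑ W ∈ V.powerset, volume (B W) := by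
        rw [lintegral_finsetSum]
        · refine Finset.sum_congr rfl fun W _ => ?_
          rw [lintegral_indicator_const (measurableSet_toMeasurable _ _), one_mul]
        · exact fun W _ => measurable_const.indicator (measurableSet_toMeasurable _ _)
    _ ≤ ∑ W ∈ V.powerset, volume (A W) := by
        refine Finset.sum_le_sum fun W _ => ?_
        rw [hB, measure_toMeasurable]
        exact hπ.lipschitzWith_reflection.volume_image_le _

/-- If the mean number of normals is maximal, then the reflection of a point of `3P` in its
nearest point of `P` lies in `P`. -/
theorem reflection_mem_of_meanNormals_eq (hπ : IsMetricProjection P π)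
    (hP : IsOSymmetricPolytope P) (hn : meanNormals P = 3 ^ m - 1)
    {x : EuclideanSpace ℝ (Fin m)} (hx : x ∈ P) :
    (2 : ℝ) • π ((3 : ℝ) • x) - (3 : ℝ) • x ∈ P := by
  obtain ⟨hb, hs, hpoly⟩ := hP
  have hclosed : IsClosed P := hb.isCompact.isClosed
  set R : EuclideanSpace ℝ (Fin m) → EuclideanSpace ℝ (Fin m) := fun x => (2 : ℝ) • π x - x with hR
  have hRc : Continuous R := hπ.lipschitzWith_reflection.continuous
  have h0 : (0 : EuclideanSpace ℝ (Fin m)) ∈ P := by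
    have := hb.convex hx (hs x hx) (a := 1 / 2) (b := 1 / 2) (by norm_num) (by norm_num)
      (by norm_num)
    simpa using this
  have hvol0 : volume P ≠ 0 := by
    have := (isOpen_interior.measure_pos volume hb.interior_nonempty)
    exact (this.trans_le (measure_mono interior_subset)).ne'
  have hvolt : volume P ≠ ⊤ := hb.isCompact.measure_lt_top.ne
  have htot : totalNormals P = (3 ^ m - 1) * volume P := by
    rw [← hn, meanNormals, ENNReal.div_mul_cancel hvol0 hvolt]
  have hsub3 : P ⊆ (3 : ℝ) • P := by
    intro y hy
    refine ⟨(1 / 3 : ℝ) • y, ?_, ?_⟩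
    · have := hb.convex hy h0 (a := 1 / 3) (b := 2 / 3) (by norm_num) (by norm_num) (by norm_num)
      simpa using this
    · simp [smul_smul]
  -- `y/3` is the convex combination of `π y` and `-R y` with weights 2/3 and 1/3.
  have hAsub : {x | x ∉ P ∧ R x ∈ P} ⊆ (3 : ℝ) • P \ P := by
    rintro y ⟨hy, hRy⟩
    refine ⟨⟨(1 / 3 : ℝ) • y, ?_, by simp [smul_smul]⟩, hy⟩
    have := hb.convex (hπ.mem y) (hs _ hRy) (a := 2 / 3) (b := 1 / 3) (by norm_num) (by norm_num)
      (by norm_num)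
    convert this using 1
    simp only [hR]
    module
  have hvol3 : volume ((3 : ℝ) • P \ P) = (3 ^ m - 1) * volume P := by
    rw [measure_sdiff hsub3 hclosed.measurableSet.nullMeasurableSet hvolt,
      Measure.addHaar_smul, finrank_euclideanSpace_fin, ENNReal.sub_mul (fun _ _ => hvolt), one_mul]
    congr 2
    rw [abs_of_nonneg (by positivity), ENNReal.ofReal_pow (by norm_num)]
    norm_num
  have hvol3t : volume ((3 : ℝ) • P \ P) ≠ ⊤ := by
    rw [hvol3]
    exact ENNReal.mul_ne_top (ENNReal.sub_ne_top (by simp)) hvolt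
  have hAmeas : MeasurableSet {x | x ∉ P ∧ R x ∈ P} :=
    hclosed.measurableSet.compl.inter (hclosed.preimage hRc).measurableSet
  have hnull : volume (((3 : ℝ) • P \ P) \ {x | x ∉ P ∧ R x ∈ P}) = 0 := by
    have hle := totalNormals_le hπ hb hpoly
    rw [measure_sdiff hAsub hAmeas.nullMeasurableSet
      (ne_top_of_le_ne_top hvol3t (measure_mono hAsub)), tsub_eq_zero_iff_le, hvol3, ← htot]
    exact hle
  -- The exceptional points inside `3P` form an open null set, hence none exist; the boundary of
  -- `3P` follows by continuity of `R`.
  have hopen : IsOpen (interior ((3 : ℝ) • P) ∩ (Pᶜ ∩ R ⁻¹' Pᶜ)) :=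
    isOpen_interior.inter (hclosed.isOpen_compl.inter (hclosed.isOpen_compl.preimage hRc))
  have hempty : interior ((3 : ℝ) • P) ∩ (Pᶜ ∩ R ⁻¹' Pᶜ) = ∅ := by
    refine hopen.eq_empty_of_measure_zero (μ := volume) (measure_mono_null ?_ hnull)
    rintro y ⟨h1, h2, h3⟩
    exact ⟨⟨interior_subset h1, h2⟩, fun h => h3 h.2⟩
  have hint : interior ((3 : ℝ) • P) ⊆ R ⁻¹' P := by
    intro y hy
    by_contra hRy
    by_cases hyP : y ∈ P
    · refine hRy ?_
      simp only [hR, Set.mem_preimage, hπ.eq_self hyP]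
      convert hyP using 1
      module
    · exact Set.notMem_empty y (hempty ▸ ⟨hy, hyP, hRy⟩)
  have hcl : closure (interior ((3 : ℝ) • P)) ⊆ R ⁻¹' P :=
    closure_minimal hint (hclosed.preimage hRc)
  have hx3 : (3 : ℝ) • x ∈ closure (interior ((3 : ℝ) • P)) := by
    have hne : (interior ((3 : ℝ) • P)).Nonempty := by
      rw [interior_smul₀ (by norm_num)]
      exact hb.interior_nonempty.smul_set
    rw [(hb.convex.smul (3 : ℝ)).closure_interior_eq_closure_of_nonempty_interior hne]
    exact subset_closure (Set.smul_mem_smul_set hx)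
  exact hcl hx3

end Measure

/-! ### Central symmetry of faces. -/

section SymmetricFaces

variable {E : Type*} [NormedAddCommGroup E] [InnerProductSpace ℝ E]

/-- If reflecting the points of `3P` in their nearest points of `P` leads into `P`, then every face
of `P` is centrally symmetric about the foot of the perpendicular from the origin. -/
theorem IsMetricProjection.exists_center {P F : Set E} {π : E → E} (hπ : IsMetricProjection P π)
    (hs : ∀ x ∈ P, -x ∈ P) (hr : ∀ x ∈ P, (2 : ℝ) • π ((3 : ℝ) • x) - (3 : ℝ) • x ∈ P)
    (hF : IsExtreme ℝ P F) (hFc : Convex ℝ F) (hFk : IsCompact F) (hne : F.Nonempty) :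
    ∃ c ∈ F, (∀ f ∈ F, inner ℝ c (f - c) = 0) ∧ ∀ f ∈ F, (2 : ℝ) • c - f ∈ F := by
  obtain ⟨ρ, hρ⟩ := exists_isMetricProjection hFk hFc hne
  obtain ⟨c, hc⟩ : ∃ c, c = ρ 0 := ⟨_, rfl⟩
  have hcF : c ∈ F := hc ▸ hρ.mem 0
  have hcle : ∀ f ∈ F, 0 ≤ inner ℝ c (f - c) := by
    intro f hf
    have := hρ.inner_le 0 f hf
    rw [← hc, zero_sub, inner_neg_left] at this
    linarith
  have split : ∀ x ∈ F, π ((3 : ℝ) • x) ∈ F ∧ (3 : ℝ) • x - (2 : ℝ) • π ((3 : ℝ) • x) ∈ F := by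
    intro x hx
    have hw : (3 : ℝ) • x - (2 : ℝ) • π ((3 : ℝ) • x) ∈ P := by
      have := hs _ (hr x (hF.subset hx))
      rwa [neg_sub] at this
    have hz := hπ.mem ((3 : ℝ) • x)
    have hseg : x ∈ openSegment ℝ (π ((3 : ℝ) • x)) ((3 : ℝ) • x - (2 : ℝ) • π ((3 : ℝ) • x)) := by
      refine ⟨2 / 3, 1 / 3, by norm_num, by norm_num, by norm_num, ?_⟩
      module
    exact ⟨hF.left_mem_of_mem_openSegment hz hw hx hseg,
      hF.left_mem_of_mem_openSegment hw hz hx ((openSegment_symm ℝ (π ((3 : ℝ) • x)) _) ▸ hseg)⟩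
  -- Both `z` and `3c - 2z = c - 2(z - c)` lie in `F`, so `z - c` is orthogonal to `c`; the
  -- projection inequality then leaves `‖z - c‖² ≤ 0`.
  have hπc : π ((3 : ℝ) • c) = c := by
    obtain ⟨h1, h2⟩ := split c hcF
    set z := π ((3 : ℝ) • c) with hz
    have h3 := hcle _ h1
    have h4 := hcle _ h2
    have h5 := hπ.inner_le ((3 : ℝ) • c) c (hF.subset hcF)
    rw [← hz] at h5
    have e1 : (3 : ℝ) • c - (2 : ℝ) • z - c = -((2 : ℝ) • (z - c)) := by module
    rw [e1, inner_neg_right, real_inner_smul_right] at h4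
    have e2 : (3 : ℝ) • c - z = (2 : ℝ) • c - (z - c) := by module
    have e3 : c - z = -(z - c) := by abel
    rw [e2, e3, inner_neg_right, inner_sub_left, real_inner_smul_left] at h5
    have : inner ℝ (z - c) (z - c) ≤ 0 := by linarith
    exact sub_eq_zero.1 (real_inner_self_nonpos.1 this)
  have horth : ∀ f ∈ F, inner ℝ c (f - c) = 0 := by
    intro f hf
    refine le_antisymm ?_ (hcle f hf)
    have := hπ.inner_le ((3 : ℝ) • c) f (hF.subset hf)
    rw [hπc] at this
    have e : (3 : ℝ) • c - c = (2 : ℝ) • c := by module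
    rw [e, real_inner_smul_left] at this
    linarith
  refine ⟨c, hcF, horth, fun f hf => ?_⟩
  -- Three times this point is `2c + f`, which projects to `f`; the second point supplied by `split`
  -- is then `2c + f - 2f = 2c - f`.
  have hy : (2 / 3 : ℝ) • c + (1 / 3 : ℝ) • f ∈ F :=
    hFc hcF hf (by norm_num) (by norm_num) (by norm_num)
  obtain ⟨h1, h2⟩ := split _ hy
  have e : (3 : ℝ) • ((2 / 3 : ℝ) • c + (1 / 3 : ℝ) • f) = (2 : ℝ) • c + f := by module
  have h5 := hπ.inner_le ((3 : ℝ) • ((2 / 3 : ℝ) • c + (1 / 3 : ℝ) • f)) f (hF.subset hf)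
  rw [e] at h1 h2 h5
  set z := π ((2 : ℝ) • c + f) with hz
  have e2 : (2 : ℝ) • c + f - z = (2 : ℝ) • c + (f - z) := by abel
  have e3 : inner ℝ c (f - z) = 0 := by
    have : f - z = (f - c) - (z - c) := by abel
    rw [this, inner_sub_right, horth f hf, horth z h1, sub_zero]
  rw [e2, inner_add_left, real_inner_smul_left, e3, mul_zero, zero_add] at h5
  have h6 : f = z := sub_eq_zero.1 (real_inner_self_nonpos.1 h5)
  rw [← h6] at h2
  convert h2 using 1
  module

end SymmetricFaces

/-! ### Faces of polytopes under perturbation of the functional; existence of edges. -/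

section Faces

open Filter Topology

variable {E : Type*} [NormedAddCommGroup E] [InnerProductSpace ℝ E]

theorem toExposed_toExposed_of_const {A : Set E} {l : StrongDual ℝ E}
    (h : ∀ x ∈ A, ∀ y ∈ A, l x = l y) : l.toExposed A = A :=
  Set.Subset.antisymm (fun _ hx => hx.1) fun x hx => ⟨hx, fun y hy => (h y hy x hx).le⟩

theorem toExposed_idem (A : Set E) (l : StrongDual ℝ E) :
    l.toExposed (l.toExposed A) = l.toExposed A :=
  toExposed_toExposed_of_const fun _ hx _ hy => le_antisymm (hy.2 _ hx.1) (hx.2 _ hy.1)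

theorem toExposed_neg_idem (A : Set E) (l : StrongDual ℝ E) :
    l.toExposed ((-l).toExposed A) = (-l).toExposed A := by
  refine toExposed_toExposed_of_const fun x hx y hy => le_antisymm ?_ ?_
  · simpa using hx.2 _ hy.1
  · simpa using hy.2 _ hx.1

open Classical in
/-- The elements of the finite set `V` at which `l` is maximal. -/
noncomputable def maxFilter (V : Finset E) (l : StrongDual ℝ E) : Finset E :=
  V.filter fun v => ∀ w ∈ V, l w ≤ l v

theorem mem_maxFilter {V : Finset E} {l : StrongDual ℝ E} {v : E} :
    v ∈ maxFilter V l ↔ v ∈ V ∧ ∀ w ∈ V, l w ≤ l v := by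
  simp [maxFilter]

theorem maxFilter_nonempty {V : Finset E} (hV : V.Nonempty) (l : StrongDual ℝ E) :
    (maxFilter V l).Nonempty := by
  obtain ⟨v, hv, h⟩ := V.exists_max_image l hV
  exact ⟨v, mem_maxFilter.2 ⟨hv, h⟩⟩

theorem le_of_mem_convexHull {V : Set E} {l : StrongDual ℝ E} {r : ℝ} (h : ∀ v ∈ V, l v ≤ r)
    {x : E} (hx : x ∈ convexHull ℝ V) : l x ≤ r :=
  convexHull_min (t := {y | l y ≤ r}) h (convex_halfSpace_le l.isLinear r) hx

theorem toExposed_convexHull (V : Finset E) (l : StrongDual ℝ E) :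
    l.toExposed (convexHull ℝ (V : Set E)) = convexHull ℝ (maxFilter V l : Set E) := by
  classical
  refine Set.Subset.antisymm ?_ ?_
  · rintro x ⟨hx, hmax⟩
    obtain ⟨w, hw0, hw1, hwx⟩ := Finset.mem_convexHull'.1 hx
    have hle : ∀ v ∈ V, l v ≤ l x := fun v hv => hmax v (subset_convexHull ℝ _ hv)
    have hsum : ∑ v ∈ V, w v * (l x - l v) = 0 := by
      have : l x = ∑ v ∈ V, w v * l v := by
        conv_lhs => rw [← hwx]
        simp [map_sum]
      simp only [mul_sub, Finset.sum_sub_distrib, ← Finset.sum_mul, hw1, one_mul]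
      linarith
    have hz := (Finset.sum_eq_zero_iff_of_nonneg fun v hv =>
      mul_nonneg (hw0 v hv) (sub_nonneg.2 (hle v hv))).1 hsum
    have hout : ∀ v ∈ V, v ∉ maxFilter V l → w v = 0 := by
      intro v hv hnv
      rcases mul_eq_zero.1 (hz v hv) with h | h
      · exact h
      · refine absurd (mem_maxFilter.2 ⟨hv, fun u hu => ?_⟩) hnv
        have := hle u hu
        linarith
    have hsub : maxFilter V l ⊆ V := Finset.filter_subset _ _
    refine Finset.mem_convexHull'.2 ⟨w, fun v hv => hw0 v (hsub hv), ?_, ?_⟩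
    · rw [← hw1]
      exact Finset.sum_subset hsub fun v hv hnv => hout v hv hnv
    · rw [← hwx]
      exact Finset.sum_subset hsub fun v hv hnv => by rw [hout v hv hnv, zero_smul]
  · refine convexHull_min ?_
      ((ContinuousLinearMap.toExposed.isExposed (l := l)).convex (convex_convexHull ℝ _))
    intro v hv
    obtain ⟨hv, h⟩ := mem_maxFilter.1 hv
    exact ⟨subset_convexHull ℝ _ hv, fun y hy => le_of_mem_convexHull h hy⟩

/-- A small tilt preserves the finitely many strict inequalities and only breaks ties. Consequently
a face of a face is a face. -/
theorem eventually_maxFilter_add_smul (V : Finset E) (l d : StrongDual ℝ E) :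
    ∀ᶠ t : ℝ in 𝓝[>] 0, maxFilter V (l + t • d) = maxFilter (maxFilter V l) d := by
  rcases V.eq_empty_or_nonempty with rfl | hV
  · simp [maxFilter]
  obtain ⟨v₀, hv₀⟩ := maxFilter_nonempty (maxFilter_nonempty hV l) d
  obtain ⟨h1, h2⟩ := mem_maxFilter.1 hv₀
  obtain ⟨h3, h4⟩ := mem_maxFilter.1 h1
  have hev : ∀ᶠ t : ℝ in 𝓝[>] 0, ∀ v ∈ V, l v < l v₀ → l v + t * d v < l v₀ + t * d v₀ := by
    refine (Finset.eventually_all V).2 fun v _ => ?_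
    by_cases hlt : l v < l v₀
    · refine Filter.Eventually.mono ?_ fun t ht _ => ht
      refine nhdsWithin_le_nhds ?_
      have hc1 : Continuous fun t : ℝ => l v + t * d v := by fun_prop
      have hc2 : Continuous fun t : ℝ => l v₀ + t * d v₀ := by fun_prop
      exact (isOpen_lt hc1 hc2).mem_nhds (by simpa using hlt)
    · exact Eventually.of_forall fun t h => absurd h hlt
  filter_upwards [hev, self_mem_nhdsWithin] with t ht htpos
  have htpos : 0 < t := htpos
  have hle : ∀ v ∈ V, l v + t * d v ≤ l v₀ + t * d v₀ := by
    intro v hv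
    rcases (h4 v hv).lt_or_eq with h | h
    · exact (ht v hv h).le
    · have hvm : v ∈ maxFilter V l := mem_maxFilter.2 ⟨hv, fun w hw => h ▸ h4 w hw⟩
      have := mul_le_mul_of_nonneg_left (h2 v hvm) htpos.le
      linarith
  ext v
  simp only [mem_maxFilter, add_apply, smul_apply,
    smul_eq_mul]
  constructor
  · rintro ⟨hv, hmax⟩
    have heq := le_antisymm (hle v hv) (hmax v₀ h3)
    have hl : l v = l v₀ := by
      by_contra hne
      exact absurd heq (ht v hv (lt_of_le_of_ne (h4 v hv) hne)).ne
    have hd : d v = d v₀ := by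
      rw [hl] at heq
      exact mul_left_cancel₀ htpos.ne' (add_left_cancel heq)
    exact ⟨⟨hv, fun w hw => hl ▸ h4 w hw⟩, fun w hw => hd ▸ h2 w (mem_maxFilter.2 hw)⟩
  · rintro ⟨⟨hv, hl⟩, hd⟩
    have e1 : l v = l v₀ := le_antisymm (h4 v hv) (hl v₀ h3)
    have e2 : d v = d v₀ := le_antisymm (h2 v (mem_maxFilter.2 ⟨hv, hl⟩)) (hd v₀ ⟨h3, h4⟩)
    exact ⟨hv, fun w hw => by rw [e1, e2]; exact hle w hw⟩

theorem eventually_toExposed_add_smul (V : Finset E) (l d : StrongDual ℝ E) :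
    ∀ᶠ t : ℝ in 𝓝[>] 0, (l + t • d).toExposed (convexHull ℝ (V : Set E)) =
      d.toExposed (l.toExposed (convexHull ℝ (V : Set E))) := by
  filter_upwards [eventually_maxFilter_add_smul V l d] with t ht
  rw [toExposed_convexHull, ht, ← toExposed_convexHull, ← toExposed_convexHull]

/-- All faces of `P` are centrally symmetric. -/
def HasSymmetricFaces (P : Set E) : Prop :=
  ∀ l : StrongDual ℝ E, ∃ c : E, ∀ x ∈ l.toExposed P, c - x ∈ l.toExposed P

/-- Reflecting a face in its centre exchanges its `d`- and `-d`-faces; the `d`-face is a face of the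
polytope, hence symmetric itself. Two point reflections compose to a translation. -/
theorem HasSymmetricFaces.exists_vadd_neg {V : Finset E}
    (hV : HasSymmetricFaces (convexHull ℝ (V : Set E))) (l d : StrongDual ℝ E) :
    ∃ τ : E, (-d).toExposed (l.toExposed (convexHull ℝ (V : Set E))) =
      τ +ᵥ d.toExposed (l.toExposed (convexHull ℝ (V : Set E))) := by
  obtain ⟨c, hc⟩ := hV l
  obtain ⟨t, ht⟩ := (eventually_toExposed_add_smul V l d).exists
  obtain ⟨c', hc'⟩ := hV (l + t • d)
  rw [ht] at hc'
  set F := l.toExposed (convexHull ℝ (V : Set E)) with hF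
  have h1 : ∀ x ∈ d.toExposed F, c - x ∈ (-d).toExposed F := by
    rintro x ⟨hx, hmax⟩
    refine ⟨hc x hx, fun y hy => ?_⟩
    have := hmax _ (hc y hy)
    simp only [map_sub, neg_apply] at this ⊢
    linarith
  have h2 : ∀ x ∈ (-d).toExposed F, c - x ∈ d.toExposed F := by
    rintro x ⟨hx, hmax⟩
    refine ⟨hc x hx, fun y hy => ?_⟩
    have := hmax _ (hc y hy)
    simp only [map_sub, neg_apply] at this ⊢
    linarith
  refine ⟨c - c', Set.Subset.antisymm (fun x hx => ?_) ?_⟩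
  · refine ⟨c' - (c - x), hc' _ (h2 x hx), ?_⟩
    simp only [vadd_eq_add]; abel
  · rintro _ ⟨x, hx, rfl⟩
    have := h1 _ (hc' x hx)
    simp only [vadd_eq_add]
    convert this using 1
    abel

/-- Move the functional along `l + t • d`. Near any `t₀` the `d`-face of the current face is the
`d`-face or the `-d`-face of the face at `t₀`, and these are translates; so its translation class is
locally constant in `t`, hence constant. -/
theorem HasSymmetricFaces.exists_vadd {V : Finset E}
    (hV : HasSymmetricFaces (convexHull ℝ (V : Set E))) (l l' : StrongDual ℝ E) :
    ∃ τ : E, (l' - l).toExposed (l'.toExposed (convexHull ℝ (V : Set E))) =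
      τ +ᵥ (l' - l).toExposed (l.toExposed (convexHull ℝ (V : Set E))) := by
  set d := l' - l with hd
  set P := convexHull ℝ (V : Set E) with hP
  set G : ℝ → Set E := fun t => d.toExposed ((l + t • d).toExposed P) with hG
  have hloc : ∀ t₀, ∀ᶠ t in 𝓝 t₀, ∃ τ : E, G t = τ +ᵥ G t₀ := by
    intro t₀
    have hr := eventually_toExposed_add_smul V (l + t₀ • d) d
    have hl := eventually_toExposed_add_smul V (l + t₀ • d) (-d)
    rw [eventually_nhdsWithin_iff, Metric.eventually_nhds_iff] at hr hl
    obtain ⟨ε, hε, hr⟩ := hr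
    obtain ⟨ε', hε', hl⟩ := hl
    refine Metric.eventually_nhds_iff.2 ⟨min ε ε', lt_min hε hε', fun t ht => ?_⟩
    rw [Real.dist_eq, lt_min_iff] at ht
    rcases lt_trichotomy t t₀ with h | h | h
    · have := hl (y := t₀ - t) (by simpa [Real.dist_eq, abs_sub_comm] using ht.2)
        (sub_pos.2 h)
      have e : l + t₀ • d + (t₀ - t) • -d = l + t • d := by module
      rw [e] at this
      obtain ⟨τ, hτ⟩ := hV.exists_vadd_neg (l + t₀ • d) d
      refine ⟨τ, ?_⟩
      simp only [hG]
      rw [this, toExposed_neg_idem, hτ]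
    · exact ⟨0, by rw [h, zero_vadd]⟩
    · have := hr (y := t - t₀) (by simpa [Real.dist_eq] using ht.1) (sub_pos.2 h)
      have e : l + t₀ • d + (t - t₀) • d = l + t • d := by module
      rw [e] at this
      refine ⟨0, ?_⟩
      simp only [hG]
      rw [this, toExposed_idem, zero_vadd]
  have hconst : IsLocallyConstant fun t => {B : Set E | ∃ τ : E, B = τ +ᵥ G t} := by
    refine (IsLocallyConstant.iff_eventually_eq _).2 fun t₀ => ?_
    filter_upwards [hloc t₀] with t ht
    obtain ⟨τ, hτ⟩ := ht
    ext B
    constructor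
    · rintro ⟨σ, rfl⟩
      exact ⟨σ + τ, by rw [hτ, vadd_vadd]⟩
    · rintro ⟨σ, rfl⟩
      exact ⟨σ - τ, by rw [hτ, vadd_vadd, sub_add_cancel]⟩
  have h01 := hconst.apply_eq_of_preconnectedSpace 1 0
  have hmem : G 1 ∈ {B : Set E | ∃ τ : E, B = τ +ᵥ G 1} := ⟨0, by rw [zero_vadd]⟩
  rw [h01] at hmem
  obtain ⟨τ, hτ⟩ := hmem
  refine ⟨τ, ?_⟩
  have e1 : l + (1 : ℝ) • d = l' := by rw [hd]; module
  have e0 : l + (0 : ℝ) • d = l := by module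
  simpa only [hG, e1, e0] using hτ

/-- A polytope that is not a point has an edge. -/
theorem exists_toExposed_eq_segment {V : Finset E} (hV : 2 ≤ V.card) :
    ∃ l : StrongDual ℝ E, ∃ a ∈ V, ∃ b ∈ V, a ≠ b ∧
      l.toExposed (convexHull ℝ (V : Set E)) = segment ℝ a b := by
  classical
  -- An edge is found as a face with the fewest points of `V`, subject to having at least two.
  have hex : ∃ n, ∃ l : StrongDual ℝ E, 2 ≤ (maxFilter V l).card ∧ (maxFilter V l).card = n := by
    refine ⟨_, 0, ?_, rfl⟩
    simpa [maxFilter] using hV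
  obtain ⟨l, hl2, hln⟩ := Nat.find_spec hex
  have hmin : ∀ l' : StrongDual ℝ E, 2 ≤ (maxFilter V l').card →
      (maxFilter V l).card ≤ (maxFilter V l').card := by
    intro l' h
    rw [hln]
    exact Nat.find_min' hex ⟨l', h, rfl⟩
  set W := maxFilter V l with hW
  have hWV : W ⊆ V := Finset.filter_subset _ _
  have hsub : ∀ d : StrongDual ℝ E, 2 ≤ (maxFilter W d).card → maxFilter W d = W := by
    intro d h
    obtain ⟨t, ht⟩ := (eventually_maxFilter_add_smul V l d).exists
    refine Finset.eq_of_subset_of_card_le (Finset.filter_subset _ _) ?_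
    rw [← ht] at h ⊢
    exact hmin _ h
  obtain ⟨p, hp, q, hq, hpq⟩ := Finset.one_lt_card.1 (by omega : 1 < W.card)
  obtain ⟨w, hwpq⟩ : ∃ w : StrongDual ℝ E, w q < w p := by
    refine ⟨innerSL ℝ (p - q), ?_⟩
    have : 0 < inner ℝ (p - q) (p - q) :=
      real_inner_self_pos.2 (sub_ne_zero.2 hpq)
    rw [inner_sub_right] at this
    simp only [innerSL_apply_apply]
    linarith
  obtain ⟨a, ha⟩ := maxFilter_nonempty ⟨p, hp⟩ w
  obtain ⟨haW, hamax⟩ := mem_maxFilter.1 ha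
  have halt : ∀ c ∈ W, c ≠ a → w c < w a := by
    intro c hc hca
    refine lt_of_le_of_ne (hamax c hc) fun heq => ?_
    have hcm : c ∈ maxFilter W w := mem_maxFilter.2 ⟨hc, fun u hu => heq ▸ hamax u hu⟩
    have := hsub w (Finset.one_lt_card.2 ⟨c, hcm, a, ha, hca⟩)
    have hqm : q ∈ maxFilter W w := by rw [this]; exact hq
    exact absurd ((mem_maxFilter.1 hqm).2 p hp) (not_le.2 hwpq)
  obtain ⟨b, hbW, hbmin⟩ := W.exists_min_image w ⟨p, hp⟩
  have hba : b ≠ a := by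
    rintro rfl
    have := hbmin q hq
    have := hamax p hp
    linarith
  -- Tilt `w` by `t • d` until the first other point ties with `a`. Minimality of `W` makes all of
  -- `W` tie at once, so `w` is proportional to `d` on `W - a`.
  have tie : ∀ d : StrongDual ℝ E, 0 < d (b - a) →
      ∃ t : ℝ, ∀ c ∈ W, w (c - a) = -(t * d (c - a)) := by
    intro d hd
    obtain ⟨c₀, hc₀, hc₀min⟩ := (W.filter fun c => 0 < d (c - a)).exists_min_image
      (fun c => w (a - c) / d (c - a)) ⟨b, Finset.mem_filter.2 ⟨hbW, hd⟩⟩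
    obtain ⟨hc₀W, hc₀d⟩ := Finset.mem_filter.1 hc₀
    set t := w (a - c₀) / d (c₀ - a) with ht
    have hc₀a : c₀ ≠ a := by rintro rfl; simp at hc₀d
    have ht0 : 0 ≤ t := by
      refine div_nonneg ?_ hc₀d.le
      have := hamax c₀ hc₀W
      rw [map_sub]; linarith
    have hle : ∀ c ∈ W, w (c - a) + t * d (c - a) ≤ 0 := by
      intro c hc
      have h1 := hamax c hc
      rcases lt_or_ge 0 (d (c - a)) with h | h
      · have := hc₀min c (Finset.mem_filter.2 ⟨hc, h⟩)
        rw [le_div_iff₀ h] at this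
        have e : w (a - c) = -w (c - a) := by rw [← map_neg, neg_sub]
        linarith
      · have := mul_nonpos_of_nonneg_of_nonpos ht0 h
        rw [map_sub w]; linarith
    have ham : a ∈ maxFilter W (w + t • d) := by
      refine mem_maxFilter.2 ⟨haW, fun c hc => ?_⟩
      have := hle c hc
      simp only [map_sub, add_apply, smul_apply,
        smul_eq_mul] at this ⊢
      linarith
    have hcm : c₀ ∈ maxFilter W (w + t • d) := by
      refine mem_maxFilter.2 ⟨hc₀W, fun c hc => ?_⟩
      have h1 := hle c hc
      have h2 : t * d (c₀ - a) = w (a - c₀) := by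
        rw [ht, div_mul_cancel₀ _ hc₀d.ne']
      simp only [map_sub, add_apply, smul_apply,
        smul_eq_mul] at h1 h2 ⊢
      linarith
    have heq := hsub _ (Finset.one_lt_card.2 ⟨c₀, hcm, a, ham, hc₀a⟩)
    refine ⟨t, fun c hc => ?_⟩
    have hc' : c ∈ maxFilter W (w + t • d) := by rw [heq]; exact hc
    have h1 := (mem_maxFilter.1 hc').2 a haW
    have h2 := hle c hc
    simp only [map_sub, add_apply, smul_apply,
      smul_eq_mul] at h1 h2 ⊢
    linarith
  have hseg : ∀ c ∈ W, c ∈ segment ℝ a b := by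
    intro c hc
    rcases eq_or_ne c a with rfl | hca
    · exact left_mem_segment ℝ _ _
    set e := b - a with he
    set g := c - a with hg
    have hg0 : 0 < inner ℝ g g := real_inner_self_pos.2 (sub_ne_zero.2 hca)
    -- A multiple of the component of `e` orthogonal to `g`. Were it nonzero, `tie` for this
    -- direction would give `w g = 0`, contradicting uniqueness of the maximizer `a`.
    set x := (inner ℝ g g) • e - (inner ℝ g e) • g with hx
    have hxg : inner ℝ x g = 0 := by
      rw [hx, inner_sub_left, real_inner_smul_left, real_inner_smul_left, real_inner_comm g e]
      ring
    have hxx : inner ℝ x x = inner ℝ g g * inner ℝ x e := by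
      conv_lhs => rw [hx, ← hx, inner_sub_right, real_inner_smul_right, real_inner_smul_right, hxg]
      ring
    have hx0 : x = 0 := by
      by_contra hne
      have hpos : 0 < inner ℝ x x := real_inner_self_pos.2 hne
      rw [hxx] at hpos
      have hxe : 0 < inner ℝ x e := (pos_iff_pos_of_mul_pos hpos).1 hg0
      obtain ⟨t, ht⟩ := tie (innerSL ℝ x) (by simpa using hxe)
      have h1 := ht c hc
      rw [innerSL_apply_apply, hxg, mul_zero, neg_zero, map_sub] at h1
      have := halt c hc hca
      linarith
    have hwe : w e < 0 := by
      have := halt b hbW hba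
      rw [he, map_sub]; linarith
    have hwg : w g < 0 := by
      have := halt c hc hca
      rw [hg, map_sub]; linarith
    have hwle : w e ≤ w g := by
      have := hbmin c hc
      rw [he, hg, map_sub, map_sub]; linarith
    have hge : g = (w g / w e) • e := by
      have h1 : (inner ℝ g g) • e = (inner ℝ g e) • g := sub_eq_zero.1 (hx ▸ hx0)
      have h2 : (inner ℝ g g) * w e = (inner ℝ g e) * w g := by
        have := congrArg w h1
        simpa using this
      have hne : inner ℝ g e ≠ 0 := by
        intro h0
        rw [h0, zero_mul] at h2
        exact (mul_neg_of_pos_of_neg hg0 hwe).ne h2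
      have h3 : (inner ℝ g e) • g = (inner ℝ g e) • (w g / w e) • e := by
        rw [← h1, smul_smul]
        congr 1
        rw [← mul_div_assoc, ← h2, mul_div_cancel_right₀ _ hwe.ne]
      exact smul_right_injective E hne h3
    rw [segment_eq_image']
    refine ⟨w g / w e, ⟨div_nonneg_of_nonpos hwg.le hwe.le, ?_⟩, ?_⟩
    · rw [div_le_one_of_neg hwe]; exact hwle
    · change a + (w g / w e) • e = c
      rw [← hge, hg]; abel
  refine ⟨l, a, hWV haW, b, hWV hbW, hba.symm, ?_⟩
  rw [toExposed_convexHull]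
  refine Set.Subset.antisymm (convexHull_min hseg (convex_segment a b)) ?_
  exact (convex_convexHull ℝ _).segment_subset (subset_convexHull ℝ _ haW)
    (subset_convexHull ℝ _ hbW)

end Faces

/-! ### Polytopes with symmetric faces are zonotopes. -/

section Zonotope

variable {E : Type*} [NormedAddCommGroup E] [InnerProductSpace ℝ E]

/-- If `P = P' + [-s, s]`, where `P'` is the set of points `x` with `x + s` and `x - s` in `P`, and
`l s > 0`, then the face of `P'` in direction `l` is symmetric if that of `P` is. -/
theorem exists_center_of_pos {P P' : Set E} {s : E}
    (hP' : ∀ x, x ∈ P' ↔ x + s ∈ P ∧ x - s ∈ P)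
    (hdec : ∀ p ∈ P, ∃ y ∈ P', ∃ r : ℝ, |r| ≤ 1 ∧ p = y + r • s) {l : StrongDual ℝ E}
    (hl : 0 < l s) {c : E} (hc : ∀ x ∈ l.toExposed P, c - x ∈ l.toExposed P) :
    ∃ c : E, ∀ x ∈ l.toExposed P', c - x ∈ l.toExposed P' := by
  refine ⟨c - (2 : ℝ) • s, fun x hx => ?_⟩
  have hxs : x + s ∈ l.toExposed P := by
    refine ⟨((hP' x).1 hx.1).1, fun p hp => ?_⟩
    obtain ⟨y, hy, r, hr, rfl⟩ := hdec p hp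
    have h1 := hx.2 y hy
    have h2 := mul_le_mul_of_nonneg_right (abs_le.1 hr).2 hl.le
    simp only [map_add, map_smul, smul_eq_mul]
    linarith
  obtain ⟨h1, h2⟩ := hc _ hxs
  obtain ⟨y, hy, r, hr, hyr⟩ := hdec _ h1
  have h3 := h2 _ hxs.1
  have h4 := hx.2 y hy
  have h5 := mul_le_mul_of_nonneg_right (abs_le.1 hr).2 hl.le
  rw [hyr] at h3
  simp only [map_add, map_smul, smul_eq_mul] at h3
  have hr1 : r = 1 := by
    have : (r - 1) * l s = 0 := by linarith
    rcases mul_eq_zero.1 this with h | h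
    · linarith
    · exact absurd h hl.ne'
  have hye : c - (2 : ℝ) • s - x = y := by
    rw [hr1, one_smul] at hyr
    have : y = c - (x + s) - s := by rw [hyr]; abel
    rw [this]; module
  rw [hye]
  refine ⟨hy, fun z hz => ?_⟩
  have := hx.2 z hz
  rw [hr1] at h3
  linarith

/-- If `l s ≠ 0`, maximizing `l` over the segment selects one end. If `l s = 0`, the centre of the
face of `P` also serves `P'`: reflection exchanges the conditions on `x + s` and `x - s`. -/
theorem HasSymmetricFaces.of_add_segment {P P' : Set E} {s : E}
    (hP : HasSymmetricFaces P) (hP' : ∀ x, x ∈ P' ↔ x + s ∈ P ∧ x - s ∈ P)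
    (hdec : ∀ p ∈ P, ∃ y ∈ P', ∃ r : ℝ, |r| ≤ 1 ∧ p = y + r • s) : HasSymmetricFaces P' := by
  intro l
  obtain ⟨c, hc⟩ := hP l
  rcases lt_trichotomy (l s) 0 with hl | hl | hl
  · refine exists_center_of_pos (s := -s) (P := P) ?_ ?_ (by rw [map_neg]; linarith) hc
    · intro x
      rw [hP' x, ← sub_eq_add_neg, sub_neg_eq_add, and_comm]
    · intro p hp
      obtain ⟨y, hy, r, hr, rfl⟩ := hdec p hp
      exact ⟨y, hy, -r, by rwa [abs_neg], by rw [neg_smul_neg]⟩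
  · refine ⟨c, fun x hx => ?_⟩
    have hmax : ∀ p ∈ P, l p ≤ l x := by
      intro p hp
      obtain ⟨y, hy, r, hr, rfl⟩ := hdec p hp
      have := hx.2 y hy
      simpa [hl] using this
    obtain ⟨h1, h2⟩ := (hP' x).1 hx.1
    obtain ⟨h3, h4⟩ := hc (x + s) ⟨h1, fun p hp => by simpa [hl] using hmax p hp⟩
    obtain ⟨h5, h6⟩ := hc (x - s) ⟨h2, fun p hp => by simpa [hl] using hmax p hp⟩
    refine ⟨(hP' _).2 ⟨?_, ?_⟩, fun y hy => ?_⟩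
    · convert h5 using 1; abel
    · convert h3 using 1; abel
    · have h7 := h4 _ ((hP' y).1 hy).1
      simpa [hl] using h7
  · exact exists_center_of_pos hP' hdec hl hc

theorem Convex.add_add_mem_of_one_lt {P : Set E} (hP : Convex ℝ P) {s y : E} {u : ℝ} (hu : 1 < u)
    (h1 : y ∈ P) (h2 : y + (u + 1) • s ∈ P) : y + s + s ∈ P := by
  have := hP h1 h2 (a := 1 - 2 / (u + 1)) (b := 2 / (u + 1))
    (by rw [sub_nonneg, div_le_one (by linarith)]; linarith) (by positivity) (by ring)
  convert this using 1
  rw [smul_add, smul_smul, div_mul_cancel₀ _ (by linarith : u + 1 ≠ 0)]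
  module

/-- An edge of a polytope with symmetric faces is a summand of the polytope. -/
theorem HasSymmetricFaces.exists_sub_edge {V : Finset E}
    (hV : HasSymmetricFaces (convexHull ℝ (V : Set E))) {l : StrongDual ℝ E} {a b : E}
    (hab : l.toExposed (convexHull ℝ (V : Set E)) = segment ℝ a b) {s : E}
    (hs : b - a = (2 : ℝ) • s) {p : E} (hp : p ∈ convexHull ℝ (V : Set E)) :
    ∃ (y : E) (r : ℝ), y + s ∈ convexHull ℝ (V : Set E) ∧ y - s ∈ convexHull ℝ (V : Set E) ∧
      |r| ≤ 1 ∧ p = y + r • s := by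
  set P := convexHull ℝ (V : Set E) with hPdef
  have hconv : Convex ℝ P := convex_convexHull ℝ _
  have hcomp : IsCompact P := V.finite_toSet.isCompact_convexHull ℝ
  have haF : a ∈ l.toExposed P := hab ▸ left_mem_segment ℝ a b
  have hbF : b ∈ l.toExposed P := hab ▸ right_mem_segment ℝ a b
  have hls : l s = 0 := by
    have h : l (b - a) = 0 := by
      rw [map_sub, sub_eq_zero]
      exact le_antisymm (haF.2 _ hbF.1) (hbF.2 _ haF.1)
    rw [hs, map_smul, smul_eq_mul] at h
    linarith
  -- Otherwise a functional `f` with `f s = 0` separates the line `p + ℝ s` from `P'`. By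
  -- `exists_vadd` the `f`-face of `P` contains a translate of the edge; its midpoint lies in `P'`
  -- but has `f`-value at least `f p`.
  obtain ⟨t, ht⟩ : ∃ t : ℝ, p + t • s + s ∈ P ∧ p + t • s - s ∈ P := by
    by_contra! hcon
    set P' : Set E := (fun x => x + s) ⁻¹' P ∩ (fun x => x - s) ⁻¹' P with hP'
    have hP'comp : IsCompact P' := by
      have h1 : P' ⊆ (fun x => x - s) '' P := fun x hx => ⟨x + s, hx.1, by simp⟩
      refine (hcomp.image (by fun_prop)).of_isClosed_subset ?_ h1
      exact (hcomp.isClosed.preimage (by fun_prop)).inter (hcomp.isClosed.preimage (by fun_prop))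
    have hP'conv : Convex ℝ P' := by
      refine Convex.inter ?_ ?_
      · exact hconv.translate_preimage_left s
      · simpa only [sub_eq_add_neg] using hconv.translate_preimage_left (-s)
    have hline : IsClosed {y : E | y - p ∈ Submodule.span ℝ {s}} :=
      (Submodule.closed_of_finiteDimensional (Submodule.span ℝ {s})).preimage
        (f := fun y => y - p) (by fun_prop)
    have hlinec : Convex ℝ {y : E | y - p ∈ Submodule.span ℝ {s}} := by
      have := (Submodule.convex (Submodule.span ℝ {s})).translate_preimage_left (-p)
      simp only [← sub_eq_add_neg] at this
      exact this
    obtain ⟨f, u, v, hfu, huv, hfv⟩ := geometric_hahn_banach_compact_closed hP'conv hP'comp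
      hlinec hline (Set.disjoint_left.2 fun x hx hx' => by
        obtain ⟨t, ht⟩ := Submodule.mem_span_singleton.1 hx'
        have e : x = p + t • s := by rw [ht]; abel
        rw [e] at hx
        exact hcon t hx.1 hx.2)
    have hft : ∀ t : ℝ, v < f p + t * f s := by
      intro t
      have := hfv (p + t • s) (by
        simp only [Set.mem_ofPred_eq, add_sub_cancel_left]
        exact Submodule.smul_mem _ _ (Submodule.mem_span_singleton_self s))
      simpa using this
    have hfs : f s = 0 := by
      by_contra h0
      have := hft ((v - f p) / f s)
      rw [div_mul_cancel₀ _ h0] at this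
      linarith
    obtain ⟨τ, hτ⟩ := hV.exists_vadd l f
    have hconst : (f - l).toExposed (l.toExposed P) = l.toExposed P := by
      refine toExposed_toExposed_of_const fun x hx y hy => ?_
      have hval : ∀ x ∈ l.toExposed P, (f - l) x = (f - l) a := by
        intro x hx
        rw [hab, segment_eq_image'] at hx
        obtain ⟨θ, _, rfl⟩ := hx
        simp [hs, hls, hfs]
      rw [hval x hx, hval y hy]
    rw [← hPdef, hconst] at hτ
    have ha : τ + a ∈ (f - l).toExposed (f.toExposed P) := hτ ▸ ⟨a, haF, rfl⟩
    have hb : τ + b ∈ (f - l).toExposed (f.toExposed P) := hτ ▸ ⟨b, hbF, rfl⟩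
    have hbe : b = a + (2 : ℝ) • s := by rw [← hs]; abel
    have hx : τ + a + s ∈ P' := by
      refine ⟨?_, ?_⟩
      · have : τ + a + s + s = τ + b := by rw [hbe]; module
        simpa only [Set.mem_preimage, this] using hb.1.1
      · simpa using ha.1.1
    have h1 := hfu _ hx
    have h2 := ha.1.2 p hp
    have h3 := hft 0
    rw [map_add, hfs] at h1
    linarith
  -- If `|t| > 1`, convexity lets `p` itself be an end of the translated segment.
  rcases lt_or_ge 1 t with h1 | h1
  · refine ⟨p + s, -1, ?_, by simpa using hp, by simp, by simp⟩
    refine Convex.add_add_mem_of_one_lt hconv h1 hp ?_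
    convert ht.1 using 1
    module
  · rcases lt_or_ge t (-1) with h2 | h2
    · refine ⟨p - s, 1, by simpa using hp, ?_, by simp, by simp⟩
      have := Convex.add_add_mem_of_one_lt (s := -s) (u := -t) hconv (by linarith) hp (by
        convert ht.2 using 1
        module)
      convert this using 1
      abel
    · refine ⟨p + t • s, -t, ht.1, ht.2, ?_, by simp⟩
      rw [abs_le]; constructor <;> linarith

/-- A polytope all of whose faces are centrally symmetric is a sum of segments. -/
theorem HasSymmetricFaces.exists_eq_sum_segment : ∀ (n : ℕ) (V : Finset E), V.card = n →
    V.Nonempty → HasSymmetricFaces (convexHull ℝ (V : Set E)) →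
    ∃ (k : ℕ) (a b : Fin k → E), convexHull ℝ (V : Set E) = ∑ i, segment ℝ (a i) (b i) := by
  classical
  intro n
  induction n using Nat.strong_induction_on with
  | _ n ih =>
  intro V hn hne hV
  rcases Nat.lt_or_ge V.card 2 with h2 | h2
  · have : V.card = 1 := by
      have := hne.card_pos
      omega
    obtain ⟨v, rfl⟩ := Finset.card_eq_one.1 this
    exact ⟨1, fun _ => v, fun _ => v, by simp⟩
  obtain ⟨l, a, haV, b, hbV, hab, hl⟩ := exists_toExposed_eq_segment h2
  set P := convexHull ℝ (V : Set E) with hP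
  have hconv : Convex ℝ P := convex_convexHull ℝ _
  obtain ⟨s, hs⟩ : ∃ s : E, b - a = (2 : ℝ) • s := ⟨(1 / 2 : ℝ) • (b - a), by simp [smul_smul]⟩
  have hbe : b = a + (2 : ℝ) • s := by rw [← hs]; abel
  have hs0 : s ≠ 0 := by
    rintro rfl
    rw [smul_zero, sub_eq_zero] at hs
    exact hab hs.symm
  have hdec : ∀ p ∈ P, ∃ (y : E) (r : ℝ), y + s ∈ P ∧ y - s ∈ P ∧ |r| ≤ 1 ∧ p = y + r • s :=
    fun p hp => hV.exists_sub_edge hl hs hp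
  choose! y r hy1 hy2 hr hyr using hdec
  set A := V.image y with hA
  have hVP : ∀ v ∈ V, v ∈ P := fun v hv => subset_convexHull ℝ _ hv
  -- Only the midpoint `y` of the edge has both `y + s` and `y - s` on it. So `a` and `b` have the
  -- same image, and `A` is smaller than `V`.
  have hmid : ∀ v ∈ V, v ∈ l.toExposed P → y v = a + s := by
    intro v hv hvF
    have haF : a ∈ l.toExposed P := hl ▸ left_mem_segment ℝ a b
    have hbF : b ∈ l.toExposed P := hl ▸ right_mem_segment ℝ a b
    have hls : l s = 0 := by
      have h : l (b - a) = 0 := by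
        rw [map_sub, sub_eq_zero]
        exact le_antisymm (haF.2 _ hbF.1) (hbF.2 _ haF.1)
      rw [hs, map_smul, smul_eq_mul] at h
      linarith
    have hlv : l v = l (y v) := by
      conv_lhs => rw [hyr v (hVP v hv)]
      simp [hls]
    have h1 : y v + s ∈ l.toExposed P := ⟨hy1 v (hVP v hv), fun z hz => by
      have := hvF.2 z hz
      rw [map_add, hls]; linarith⟩
    have h2 : y v - s ∈ l.toExposed P := ⟨hy2 v (hVP v hv), fun z hz => by
      have := hvF.2 z hz
      rw [map_sub, hls]; linarith⟩
    rw [hl, segment_eq_image'] at h1 h2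
    obtain ⟨θ, hθ, h1⟩ := h1
    obtain ⟨θ', hθ', h2⟩ := h2
    simp only [hs] at h1 h2
    have h3 : (2 * θ - 2 * θ' - 2) • s = 0 := by
      have : (2 * θ - 2 * θ' - 2) • s
          = (a + θ • (2 : ℝ) • s) - (a + θ' • (2 : ℝ) • s) - (2 : ℝ) • s := by module
      rw [this, h1, h2]; module
    have h4 : 2 * θ - 2 * θ' - 2 = 0 := (smul_eq_zero.1 h3).resolve_right hs0
    have h5 : θ' = 0 := by linarith [hθ.2, hθ'.1]
    rw [h5, zero_smul, add_zero] at h2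
    rw [h2]; abel
  have hcard : A.card < V.card := by
    refine lt_of_le_of_ne Finset.card_image_le fun h => ?_
    have hinj := Finset.card_image_iff.1 h
    refine hab (hinj haV hbV ?_)
    rw [hmid a haV (hl ▸ left_mem_segment ℝ a b), hmid b hbV (hl ▸ right_mem_segment ℝ a b)]
  set P' : Set E := {x | x + s ∈ P ∧ x - s ∈ P} with hP'
  have hP'conv : Convex ℝ P' := by
    refine Convex.inter (s := (fun x => x + s) ⁻¹' P) (t := (fun x => x - s) ⁻¹' P) ?_ ?_
    · exact hconv.translate_preimage_left s
    · simpa only [sub_eq_add_neg] using hconv.translate_preimage_left (-s)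
  have hAP' : convexHull ℝ (A : Set E) = P' := by
    refine Set.Subset.antisymm (convexHull_min ?_ hP'conv) fun x hx => ?_
    · intro z hz
      obtain ⟨v, hv, rfl⟩ := Finset.mem_image.1 (Finset.mem_coe.1 hz)
      exact ⟨hy1 v (hVP v hv), hy2 v (hVP v hv)⟩
    -- If `f` separates `x` from the hull of `A` at level `u`, then `f ≤ u + |f s|` on `P`, which
    -- one of `x + s`, `x - s` violates.
    · by_contra hxA
      obtain ⟨f, u, hfu, hux⟩ := geometric_hahn_banach_closed_point (convex_convexHull ℝ _)
        (A.finite_toSet.isCompact_convexHull ℝ).isClosed hxA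
      have hle : ∀ z ∈ P, f z ≤ u + |f s| := by
        intro z hz
        refine le_of_mem_convexHull (fun v hv => ?_) hz
        have h1 := hfu (y v) (subset_convexHull ℝ _ (Finset.mem_image_of_mem y hv))
        have h2 : r v * f s ≤ |f s| := by
          calc r v * f s ≤ |r v * f s| := le_abs_self _
            _ = |r v| * |f s| := abs_mul _ _
            _ ≤ 1 * |f s| := by gcongr; exact hr v (hVP v hv)
            _ = |f s| := one_mul _
        rw [hyr v (hVP v hv), map_add, map_smul, smul_eq_mul]
        linarith
      have h1 := hle _ hx.1
      have h2 := hle _ hx.2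
      rw [map_add] at h1
      rw [map_sub] at h2
      rcases abs_cases (f s) with ⟨h, _⟩ | ⟨h, _⟩ <;> linarith
  have hsym : HasSymmetricFaces P' :=
    hV.of_add_segment (fun _ => Iff.rfl) fun p hp =>
      ⟨y p, ⟨hy1 p hp, hy2 p hp⟩, r p, hr p hp, hyr p hp⟩
  obtain ⟨k, α, β, hk⟩ := ih A.card (hn ▸ hcard) A rfl (hne.image y) (hAP' ▸ hsym)
  refine ⟨k + 1, Fin.snoc α (-s), Fin.snoc β s, ?_⟩
  rw [Fin.sum_univ_castSucc]
  simp only [Fin.snoc_castSucc, Fin.snoc_last]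
  rw [← hk, hAP']
  refine Set.Subset.antisymm (fun p hp => ?_) ?_
  · refine ⟨y p, ⟨hy1 p hp, hy2 p hp⟩, r p • s, ?_, (hyr p hp).symm⟩
    have := abs_le.1 (hr p hp)
    refine ⟨(1 - r p) / 2, (1 + r p) / 2, by linarith, by linarith, by ring, ?_⟩
    module
  · rintro _ ⟨z, hz, _, ⟨c, d, hc, hd, hcd, rfl⟩, rfl⟩
    have := hconv hz.2 hz.1 hc hd hcd
    convert this using 1
    have : z = (c + d) • z := by rw [hcd, one_smul]
    nth_rewrite 1 [this]
    module

end Zonotope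

/-! ### Edges with ends of equal norm; absence of acute angles. -/

section Polygons

variable {E : Type*} [NormedAddCommGroup E] [InnerProductSpace ℝ E]

/-- If all faces of `P` are symmetric about the feet of the perpendiculars from the origin, then
the ends of an edge have the same norm. -/
theorem norm_eq_of_isExtreme_segment {P : Set E} {π : E → E} (hπ : IsMetricProjection P π)
    (hs : ∀ x ∈ P, -x ∈ P) (hr : ∀ x ∈ P, (2 : ℝ) • π ((3 : ℝ) • x) - (3 : ℝ) • x ∈ P)
    {x y : E} (hxy : IsExtreme ℝ P (segment ℝ x y)) : ‖x‖ = ‖y‖ := by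
  rcases eq_or_ne x y with rfl | hne
  · rfl
  have hk : IsCompact (segment ℝ x y) := by
    rw [← convexHull_pair]
    exact ((Set.finite_singleton y).insert x).isCompact_convexHull ℝ
  obtain ⟨c, hc, horth, hsym⟩ := hπ.exists_center hs hr hxy (convex_segment x y) hk
    ⟨x, left_mem_segment ℝ x y⟩
  have hd : y - x ≠ 0 := sub_ne_zero.2 hne.symm
  rw [segment_eq_image'] at hc hsym
  obtain ⟨t, ht, rfl⟩ := hc
  obtain ⟨t₁, ht₁, h₁⟩ := hsym x ⟨0, by simp, by simp⟩
  obtain ⟨t₂, ht₂, h₂⟩ := hsym y ⟨1, by simp, by simp⟩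
  have e₁ : (2 * t - t₁) • (y - x) = 0 := by
    have : (2 * t - t₁) • (y - x) = (2 : ℝ) • (x + t • (y - x)) - x - (x + t₁ • (y - x)) := by
      module
    rw [this, ← h₁, sub_self]
  have e₂ : (2 * t - 1 - t₂) • (y - x) = 0 := by
    have : (2 * t - 1 - t₂) • (y - x)
        = (2 : ℝ) • (x + t • (y - x)) - y - (x + t₂ • (y - x)) := by module
    rw [this, ← h₂, sub_self]
  have e₁ := (smul_eq_zero.1 e₁).resolve_right hd
  have e₂ := (smul_eq_zero.1 e₂).resolve_right hd
  have ht : t = 1 / 2 := by linarith [ht₁.2, ht₂.1]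
  have o₁ := horth x (left_mem_segment ℝ x y)
  have o₂ := horth y (right_mem_segment ℝ x y)
  have e : inner ℝ ((2 : ℝ) • (x + t • (y - x))) (x - y) = 0 := by
    have : x - y = (x - (x + t • (y - x))) - (y - (x + t • (y - x))) := by abel
    rw [this, real_inner_smul_left, inner_sub_right, o₁, o₂]; simp
  have e' : (2 : ℝ) • (x + t • (y - x)) = x + y := by rw [ht]; module
  rw [e', real_inner_add_sub_eq_zero_iff] at e
  exact e

/-- Equality would put `z` on the edge `[x, y]`; positivity of the inner product makes the two edges
point the same way, so each contains the other. -/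
theorem apply_neg_of_acute_edges {F : Set E} {l l' : StrongDual ℝ E} {x y z : E}
    (hl : segment ℝ x y = l.toExposed F) (hl' : segment ℝ x z = l'.toExposed F)
    (hyz : y ≠ z) (hpos : 0 < inner ℝ (y - x) (z - x)) : l (z - x) < 0 := by
  have hx : x ∈ l.toExposed F := hl ▸ left_mem_segment ℝ x y
  have hy : y ∈ l.toExposed F := hl ▸ right_mem_segment ℝ x y
  have hz : z ∈ l'.toExposed F := hl' ▸ right_mem_segment ℝ x z
  have hx' : x ∈ l'.toExposed F := hl' ▸ left_mem_segment ℝ x z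
  have hle : l (z - x) ≤ 0 := by
    have := hx.2 z hz.1
    rw [map_sub]; linarith
  refine lt_of_le_of_ne hle fun h0 => hyz ?_
  rw [map_sub, sub_eq_zero] at h0
  have hzl : z ∈ segment ℝ x y := by
    rw [hl]
    exact ⟨hz.1, fun w hw => h0 ▸ hx.2 w hw⟩
  have h0' : l' z = l' x := le_antisymm (hx'.2 z hz.1) (hz.2 x hx.1)
  rw [segment_eq_image'] at hzl
  obtain ⟨t, ht, htz⟩ := hzl
  simp only at htz
  have hzx : z - x = t • (y - x) := by rw [← htz]; abel
  have ht0 : 0 < t := by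
    refine lt_of_le_of_ne ht.1 fun h => ?_
    rw [hzx, ← h, zero_smul, inner_zero_right] at hpos
    exact lt_irrefl _ hpos
  have hy0 : y - x ≠ 0 := by
    rintro h
    rw [h, inner_zero_left] at hpos
    exact lt_irrefl _ hpos
  have h1 : l' (y - x) = 0 := by
    have : l' (z - x) = 0 := by rw [map_sub, h0', sub_self]
    rw [hzx, map_smul, smul_eq_mul] at this
    exact (mul_eq_zero.1 this).resolve_left ht0.ne'
  have hyl : y ∈ segment ℝ x z := by
    rw [map_sub, sub_eq_zero] at h1
    rw [hl']
    exact ⟨hy.1, fun w hw => h1 ▸ hx'.2 w hw⟩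
  rw [segment_eq_image'] at hyl
  obtain ⟨t', ht', hty⟩ := hyl
  simp only at hty
  have h2 : (t' * t - 1) • (y - x) = 0 := by
    have : (t' * t - 1) • (y - x) = x + t' • (z - x) - y := by rw [hzx]; module
    rw [this, hty, sub_self]
  have h3 := (smul_eq_zero.1 h2).resolve_right hy0
  have h4 : t = 1 := by
    have := mul_le_mul_of_nonneg_right ht'.2 ht0.le
    linarith [ht.2]
  rw [h4, one_smul] at hzx
  exact (sub_left_injective hzx).symm

theorem finrank_span_pair_of_linearIndependent {u v : E} (h : LinearIndependent ℝ ![u, v]) :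
    Module.finrank ℝ (Submodule.span ℝ ({u, v} : Set E)) = 2 := by
  have := finrank_span_eq_card h
  rwa [Matrix.range_cons_cons_empty, Fintype.card_fin] at this

/-- The antipode `y' = 2c - y` lies in `F`, and `y' - x` is orthogonal to `y - x` because `‖x‖ =
‖y‖` and `c` is orthogonal to `F`. But `y' - x` is in the cone of `y - x` and `z - x`, so an acute
angle forces `y' = x`; then the antipode of `z` lies beyond the line of the edge `[x, y]`. -/
theorem inner_nonpos_of_edges {P F : Set E} {π : E → E} (hπ : IsMetricProjection P π)
    (hs : ∀ x ∈ P, -x ∈ P) (hr : ∀ x ∈ P, (2 : ℝ) • π ((3 : ℝ) • x) - (3 : ℝ) • x ∈ P)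
    (hFe : IsExtreme ℝ P F) (hFc : Convex ℝ F) (hFk : IsCompact F)
    (hdim : Module.finrank ℝ (vectorSpan ℝ F) = 2) {x y z : E}
    (hxy : IsExposed ℝ F (segment ℝ x y)) (hxz : IsExposed ℝ F (segment ℝ x z)) (hyz : y ≠ z) :
    inner ℝ (y - x) (z - x) ≤ 0 := by
  by_contra! hpos
  obtain ⟨l, hl⟩ := hxy ⟨x, left_mem_segment ℝ x y⟩
  obtain ⟨l', hl'⟩ := hxz ⟨x, left_mem_segment ℝ x z⟩
  have hlz : l (z - x) < 0 := apply_neg_of_acute_edges hl hl' hyz hpos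
  have hly : l' (y - x) < 0 := apply_neg_of_acute_edges hl' hl hyz.symm (by rwa [real_inner_comm])
  have hx : x ∈ l.toExposed F := by
    rw [ContinuousLinearMap.toExposed, ← hl]; exact left_mem_segment ℝ x y
  have hy : y ∈ l.toExposed F := by
    rw [ContinuousLinearMap.toExposed, ← hl]; exact right_mem_segment ℝ x y
  have hx' : x ∈ l'.toExposed F := by
    rw [ContinuousLinearMap.toExposed, ← hl']; exact left_mem_segment ℝ x z
  have hz : z ∈ l'.toExposed F := by
    rw [ContinuousLinearMap.toExposed, ← hl']; exact right_mem_segment ℝ x z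
  have hly0 : l (y - x) = 0 := by
    rw [map_sub, sub_eq_zero]
    exact le_antisymm (hx.2 y hy.1) (hy.2 x hx.1)
  have hlz0 : l' (z - x) = 0 := by
    rw [map_sub, sub_eq_zero]
    exact le_antisymm (hx'.2 z hz.1) (hz.2 x hx'.1)
  obtain ⟨c, hc, horth, hsym⟩ := hπ.exists_center hs hr hFe hFc hFk ⟨x, hx.1⟩
  have hnorm : ‖x‖ = ‖y‖ := norm_eq_of_isExtreme_segment hπ hs hr (hFe.trans hxy.isExtreme)
  have hli : LinearIndependent ℝ ![y - x, z - x] := by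
    refine LinearIndependent.pair_iff.2 fun a b hab => ?_
    have h1 := congrArg l hab
    have h2 := congrArg l' hab
    simp only [map_add, map_smul, smul_eq_mul, map_zero, hly0, hlz0, mul_zero, zero_add,
      add_zero] at h1 h2
    exact ⟨(mul_eq_zero.1 h2).resolve_right hly.ne, (mul_eq_zero.1 h1).resolve_right hlz.ne⟩
  have hspan : Submodule.span ℝ ({y - x, z - x} : Set E) = vectorSpan ℝ F := by
    have : FiniteDimensional ℝ (vectorSpan ℝ F) :=
      FiniteDimensional.of_finrank_pos (by rw [hdim]; norm_num)
    refine Submodule.eq_of_le_of_finrank_eq (Submodule.span_le.2 ?_) ?_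
    · rintro w (rfl | rfl)
      · exact vsub_mem_vectorSpan ℝ hy.1 hx.1
      · exact vsub_mem_vectorSpan ℝ hz.1 hx.1
    · rw [hdim, finrank_span_pair_of_linearIndependent hli]
  have hyF := hsym y hy.1
  have hw : (2 : ℝ) • c - y - x ∈ Submodule.span ℝ ({y - x, z - x} : Set E) := by
    rw [hspan]
    exact vsub_mem_vectorSpan ℝ hyF hx.1
  obtain ⟨α, β, hαβ⟩ := Submodule.mem_span_pair.1 hw
  have hβ : 0 ≤ β := by
    have h1 := congrArg l hαβ
    have h2 := hx.2 _ hyF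
    rw [map_add, map_smul, map_smul, hly0, smul_zero, zero_add, smul_eq_mul,
      map_sub l (_ - y)] at h1
    by_contra! h
    have := mul_pos_of_neg_of_neg h hlz
    linarith
  have hα : 0 ≤ α := by
    have h1 := congrArg l' hαβ
    have h2 := hx'.2 _ hyF
    rw [map_add, map_smul, map_smul, hlz0, smul_zero, add_zero, smul_eq_mul,
      map_sub l' (_ - y)] at h1
    by_contra! h
    have := mul_pos_of_neg_of_neg h hly
    linarith
  have hinner : inner ℝ ((2 : ℝ) • c - y - x) (y - x) = 0 := by
    have h1 := horth x hx.1
    have h2 := horth y hy.1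
    have h3 : inner ℝ (x + y) (x - y) = 0 := (real_inner_add_sub_eq_zero_iff x y).2 hnorm
    have e1 : (2 : ℝ) • c - y - x = (2 : ℝ) • c - (x + y) := by abel
    have e2 : inner ℝ c (y - x) = 0 := by
      have : y - x = (y - c) - (x - c) := by abel
      rw [this, inner_sub_right, h1, h2, sub_zero]
    rw [e1, inner_sub_left, real_inner_smul_left, e2, ← neg_sub x y, inner_neg_right, h3]
    simp
  have hy0 : 0 < inner ℝ (y - x) (y - x) := by
    refine real_inner_self_pos.2 fun h => ?_
    rw [h, inner_zero_left] at hpos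
    exact lt_irrefl _ hpos
  rw [← hαβ, inner_add_left, real_inner_smul_left, real_inner_smul_left,
    real_inner_comm (y - x) (z - x)] at hinner
  have hα0 : α = 0 := by
    by_contra h
    have := mul_pos (lt_of_le_of_ne hα (Ne.symm h)) hy0
    have := mul_nonneg hβ hpos.le
    linarith
  have hβ0 : β = 0 := by
    by_contra h
    have := mul_pos (lt_of_le_of_ne hβ (Ne.symm h)) hpos
    have := mul_nonneg hα hy0.le
    linarith
  rw [hα0, hβ0, zero_smul, zero_smul, add_zero] at hαβ
  have h1 := congrArg l hαβ
  have h2 := hx.2 _ (hsym z hz.1)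
  simp only [map_zero, map_sub, map_smul, smul_eq_mul] at h1 h2 hly0 hlz
  linarith

end Polygons

/-! ### The Sylvester–Gallai theorem by Kelly's argument. -/

section SylvesterGallai

variable {E : Type*} [NormedAddCommGroup E] [InnerProductSpace ℝ E]

/-- The Gram determinant of `b - a` and `p - a`: four times the squared area of the triangle
`a b p`. -/
noncomputable def triangleGram (a b p : E) : ℝ :=
  inner ℝ (b - a) (b - a) * inner ℝ (p - a) (p - a) - inner ℝ (b - a) (p - a) ^ 2

theorem eq_add_smul_of_triangleGram_nonpos {a b p : E} (hab : a ≠ b)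
    (h : triangleGram a b p ≤ 0) :
    p = a + (inner ℝ (b - a) (p - a) / inner ℝ (b - a) (b - a)) • (b - a) := by
  have hpos : 0 < inner ℝ (b - a) (b - a) := real_inner_self_pos.2 (sub_ne_zero.2 hab.symm)
  set e := b - a
  set g := p - a with hg
  set x := g - (inner ℝ e g / inner ℝ e e) • e with hx
  have hxx : inner ℝ x x = triangleGram a b p / inner ℝ e e := by
    have ht : triangleGram a b p = inner ℝ e e * inner ℝ g g - inner ℝ e g ^ 2 := rfl
    rw [ht]
    simp only [hx, inner_sub_left, inner_sub_right, real_inner_smul_left, real_inner_smul_right,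
      real_inner_comm e g]
    field_simp
    ring
  have h0 : x = 0 := by
    refine real_inner_self_nonpos.1 ?_
    rw [hxx]
    exact div_nonpos_of_nonpos_of_nonneg h hpos.le
  rw [hx, sub_eq_zero] at h0
  rw [← h0, hg]; abel

/-- The Sylvester–Gallai theorem: a finite set of points that are not all collinear has a line
containing exactly two of them. -/
theorem exists_ordinary_line {S : Finset E}
    (hS : ∃ a ∈ S, ∃ b ∈ S, ∃ p ∈ S, 0 < triangleGram a b p) :
    ∃ a ∈ S, ∃ b ∈ S, a ≠ b ∧ ∀ t : ℝ, a + t • (b - a) ∈ S → t = 0 ∨ t = 1 := by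
  classical
  obtain ⟨a₀, ha₀, b₀, hb₀, p₀, hp₀, h₀⟩ := hS
  -- The minimized quotient is the squared distance from `p` to the line `ab`.
  obtain ⟨⟨a, b, p⟩, hmem, hmin⟩ := ((S ×ˢ S ×ˢ S).filter
    fun T => 0 < triangleGram T.1 T.2.1 T.2.2).exists_min_image
    (fun T => triangleGram T.1 T.2.1 T.2.2 / inner ℝ (T.2.1 - T.1) (T.2.1 - T.1))
    ⟨(a₀, b₀, p₀), by simp [ha₀, hb₀, hp₀, h₀]⟩
  simp only [Finset.mem_filter, Finset.mem_product] at hmem hmin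
  obtain ⟨⟨ha, hb, hp⟩, hg⟩ := hmem
  have hab : a ≠ b := by
    rintro rfl
    simp [triangleGram] at hg
  refine ⟨a, ha, b, hb, hab, fun t ht => ?_⟩
  by_contra! hcon
  obtain ⟨ht0, ht1⟩ := hcon
  obtain ⟨e, he⟩ : ∃ e, e = b - a := ⟨_, rfl⟩
  have hee : 0 < inner ℝ e e := by
    rw [he]; exact real_inner_self_pos.2 (sub_ne_zero.2 hab.symm)
  obtain ⟨μ, hμ⟩ : ∃ μ, μ = inner ℝ e (p - a) / inner ℝ e e := ⟨_, rfl⟩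
  obtain ⟨y, hy⟩ : ∃ y, y = p - a - μ • e := ⟨_, rfl⟩
  have hey : inner ℝ e y = 0 := by
    rw [hy, inner_sub_right, real_inner_smul_right, hμ, div_mul_cancel₀ _ hee.ne', sub_self]
  have hpa : p - a = y + μ • e := by rw [hy]; abel
  have hgram : triangleGram a b p = inner ℝ e e * inner ℝ y y := by
    simp only [triangleGram, hpa, ← he, inner_add_left, inner_add_right, real_inner_smul_left,
      real_inner_smul_right, real_inner_comm e y, hey]
    ring
  have hyy : 0 < inner ℝ y y := (pos_iff_pos_of_mul_pos (hgram ▸ hg)).1 hee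
  -- Coordinates `r` start at the foot of the perpendicular from `p`. If the inequality failed, the
  -- point `r₁` would be closer to the line through `p` and `r₂` than `p` is to `ab`. Hence any two
  -- points lie strictly on opposite sides of the foot, impossible for three.
  have key : ∀ r₁ r₂ : ℝ, a + (μ + r₁) • e ∈ S → a + (μ + r₂) • e ∈ S → r₁ ≠ r₂ →
      r₂ ^ 2 < (r₁ - r₂) ^ 2 := by
    intro r₁ r₂ h₁ h₂ hne
    by_contra! hle
    have e1 : p - (a + (μ + r₂) • e) = y - r₂ • e := by
      rw [hy]; module
    have e2 : a + (μ + r₁) • e - (a + (μ + r₂) • e) = (r₁ - r₂) • e := by module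
    have hD : inner ℝ (p - (a + (μ + r₂) • e)) (p - (a + (μ + r₂) • e))
        = inner ℝ y y + r₂ ^ 2 * inner ℝ e e := by
      rw [e1]
      simp only [inner_sub_left, inner_sub_right, real_inner_smul_left, real_inner_smul_right,
        real_inner_comm e y, hey]
      ring
    have hG : triangleGram (a + (μ + r₂) • e) p (a + (μ + r₁) • e)
        = (r₁ - r₂) ^ 2 * inner ℝ e e * inner ℝ y y := by
      rw [triangleGram, hD, e1, e2]
      simp only [inner_sub_left, real_inner_smul_left, real_inner_smul_right,
        real_inner_comm e y, hey]
      ring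
    have hsq : 0 < (r₁ - r₂) ^ 2 := by
      have := sub_ne_zero.2 hne
      positivity
    have hmin' := hmin (a + (μ + r₂) • e, p, a + (μ + r₁) • e)
      ⟨⟨h₂, hp, h₁⟩, by rw [hG]; positivity⟩
    simp only [hG, hD, hgram, ← he] at hmin'
    rw [mul_div_cancel_left₀ _ hee.ne', le_div_iff₀ (by positivity)] at hmin'
    have h3 := mul_le_mul_of_nonneg_right hle (mul_pos hee hyy).le
    have h4 := mul_pos hyy hyy
    nlinarith
  have hpts : ∀ r : ℝ, r = -μ ∨ r = 1 - μ ∨ r = t - μ → a + (μ + r) • e ∈ S := by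
    rintro r (rfl | rfl | rfl)
    · simpa using ha
    · simpa [he] using hb
    · simpa [he] using ht
  have neg : ∀ r₁ r₂ : ℝ, (r₁ = -μ ∨ r₁ = 1 - μ ∨ r₁ = t - μ) →
      (r₂ = -μ ∨ r₂ = 1 - μ ∨ r₂ = t - μ) → r₁ ≠ r₂ → r₁ * r₂ < 0 := by
    intro r₁ r₂ h₁ h₂ hne
    have k₁ := key r₁ r₂ (hpts _ h₁) (hpts _ h₂) hne
    have k₂ := key r₂ r₁ (hpts _ h₂) (hpts _ h₁) hne.symm
    nlinarith [sq_nonneg (r₁ - r₂), sq_nonneg (r₁ + r₂), mul_self_nonneg (r₁ * r₂)]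
  have n₁ := neg (-μ) (1 - μ) (by simp) (by simp) (by intro h; linarith)
  have n₂ := neg (-μ) (t - μ) (by simp) (by simp) (by intro h; exact ht0 (by linarith))
  have n₃ := neg (1 - μ) (t - μ) (by simp) (by simp) (by intro h; exact ht1 (by linarith))
  nlinarith [mul_pos_of_neg_of_neg n₁ n₂, sq_nonneg (-μ)]

end SylvesterGallai

/-! ### Faces of Minkowski sums; parallelograms. -/

section FacesOfSums

variable {E : Type*} [NormedAddCommGroup E] [InnerProductSpace ℝ E]

theorem toExposed_add (A B : Set E) (l : StrongDual ℝ E) :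
    l.toExposed (A + B) = l.toExposed A + l.toExposed B := by
  ext x
  constructor
  · rintro ⟨⟨a, ha, b, hb, rfl⟩, hmax⟩
    refine ⟨a, ⟨ha, fun y hy => ?_⟩, b, ⟨hb, fun y hy => ?_⟩, rfl⟩
    · simpa using hmax _ (Set.add_mem_add hy hb)
    · simpa using hmax _ (Set.add_mem_add ha hy)
  · rintro ⟨a, ⟨ha, ha'⟩, b, ⟨hb, hb'⟩, rfl⟩
    refine ⟨Set.add_mem_add ha hb, ?_⟩
    rintro _ ⟨y, hy, z, hz, rfl⟩
    simpa using add_le_add (ha' y hy) (hb' z hz)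

theorem toExposed_singleton (x : E) (l : StrongDual ℝ E) : l.toExposed {x} = {x} :=
  toExposed_toExposed_of_const (by simp)

theorem toExposed_sum {ι : Type*} (s : Finset ι) (A : ι → Set E) (l : StrongDual ℝ E) :
    l.toExposed (∑ i ∈ s, A i) = ∑ i ∈ s, l.toExposed (A i) := by
  classical
  induction s using Finset.induction_on with
  | empty =>
    rw [Finset.sum_empty, Finset.sum_empty]
    exact toExposed_singleton (0 : E) l
  | insert i s hi ih => rw [Finset.sum_insert hi, Finset.sum_insert hi, toExposed_add, ih]

theorem toExposed_segment_of_eq {a b : E} {l : StrongDual ℝ E} (h : l (b - a) = 0) :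
    l.toExposed (segment ℝ a b) = segment ℝ a b := by
  refine toExposed_toExposed_of_const fun x hx y hy => ?_
  rw [segment_eq_image'] at hx hy
  obtain ⟨θ, _, rfl⟩ := hx
  obtain ⟨θ', _, rfl⟩ := hy
  simp only [map_add, map_smul, h, smul_zero]

theorem toExposed_segment_of_pos {a b : E} {l : StrongDual ℝ E} (h : 0 < l (b - a)) :
    l.toExposed (segment ℝ a b) = {b} := by
  have hval : ∀ x ∈ segment ℝ a b, ∃ θ : ℝ, 0 ≤ θ ∧ x = b - θ • (b - a) := by
    intro x hx
    rw [segment_eq_image'] at hx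
    obtain ⟨θ, hθ, rfl⟩ := hx
    exact ⟨1 - θ, by linarith [hθ.2], by module⟩
  ext x
  constructor
  · rintro ⟨hx, hmax⟩
    obtain ⟨θ, hθ, rfl⟩ := hval x hx
    have := hmax b (right_mem_segment ℝ a b)
    rw [map_sub, map_smul, smul_eq_mul] at this
    have h0 : θ = 0 := by
      by_contra hne
      have := mul_pos (lt_of_le_of_ne hθ (Ne.symm hne)) h
      linarith
    simp [h0]
  · rintro rfl
    refine ⟨right_mem_segment ℝ a _, fun y hy => ?_⟩
    obtain ⟨θ, hθ, rfl⟩ := hval y hy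
    have := mul_nonneg hθ h.le
    rw [map_sub, map_smul, smul_eq_mul]
    linarith

theorem toExposed_segment_of_neg {a b : E} {l : StrongDual ℝ E} (h : l (b - a) < 0) :
    l.toExposed (segment ℝ a b) = {a} := by
  rw [segment_symm]
  refine toExposed_segment_of_pos ?_
  rw [← neg_sub, map_neg]
  linarith

theorem smul_segment_zero (r : ℝ) (u : E) : r • segment ℝ 0 u = segment ℝ 0 (r • u) := by
  rw [← convexHull_pair, ← convexHull_smul, ← Set.image_smul, Set.image_pair, smul_zero,
    convexHull_pair]

theorem singleton_add_segment_zero (x u : E) : {x} + segment ℝ 0 u = segment ℝ x (x + u) := by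
  rw [← convexHull_singleton (𝕜 := ℝ) x, ← convexHull_pair, ← convexHull_add, ← convexHull_pair,
    Set.singleton_add, Set.image_pair, add_zero]

theorem parallelogram_eq_convexHull (x u v : E) :
    {x} + segment ℝ 0 u + segment ℝ 0 v = convexHull ℝ {x, x + u, x + u + v, x + v} := by
  rw [singleton_add_segment_zero, ← convexHull_pair, ← convexHull_pair, ← convexHull_add]
  congr 1
  ext y
  simp only [Set.mem_add, Set.mem_insert_iff, Set.mem_singleton_iff]
  constructor
  · rintro ⟨_, rfl | rfl, _, rfl | rfl, rfl⟩ <;> simp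
  · rintro (rfl | rfl | rfl | rfl)
    · exact ⟨y, by simp, 0, by simp, by simp⟩
    · exact ⟨x + u, by simp, 0, by simp, by simp⟩
    · exact ⟨x + u, by simp, v, by simp, by simp⟩
    · exact ⟨x, by simp, v, by simp, by simp⟩

theorem finrank_vectorSpan_parallelogram {x u v : E} (h : LinearIndependent ℝ ![u, v]) :
    Module.finrank ℝ (vectorSpan ℝ ({x} + segment ℝ 0 u + segment ℝ 0 v)) = 2 := by
  have e : vectorSpan ℝ ({x} + segment ℝ 0 u + segment ℝ 0 v) = Submodule.span ℝ {u, v} := by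
    have hx : x ∈ {x} + segment ℝ 0 u + segment ℝ 0 v :=
      ⟨x, ⟨x, rfl, 0, left_mem_segment ℝ 0 u, by simp⟩, 0, left_mem_segment ℝ 0 v, by simp⟩
    refine le_antisymm ?_ (Submodule.span_le.2 ?_)
    · rw [vectorSpan_eq_span_vsub_set_right ℝ hx]
      refine Submodule.span_le.2 ?_
      rintro _ ⟨_, ⟨_, ⟨_, rfl, y, hy, rfl⟩, z, hz, rfl⟩, rfl⟩
      rw [segment_eq_image'] at hy hz
      obtain ⟨s, _, rfl⟩ := hy
      obtain ⟨t, _, rfl⟩ := hz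
      refine Submodule.mem_span_pair.2 ⟨s, t, ?_⟩
      simp only [vsub_eq_sub]
      module
    · rintro w (rfl | rfl)
      · have h1 : x + w ∈ {x} + segment ℝ 0 w + segment ℝ 0 v :=
          ⟨x + w, ⟨x, rfl, w, right_mem_segment ℝ 0 w, rfl⟩, 0, left_mem_segment ℝ 0 v, by simp⟩
        simpa using vsub_mem_vectorSpan ℝ h1 hx
      · have h1 : x + w ∈ {x} + segment ℝ 0 u + segment ℝ 0 w :=
          ⟨x, ⟨x, rfl, 0, left_mem_segment ℝ 0 u, by simp⟩, w, right_mem_segment ℝ 0 w, rfl⟩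
        simpa using vsub_mem_vectorSpan ℝ h1 hx
  rw [e, finrank_span_pair_of_linearIndependent h]

/-- A parallelogram whose sides parallel to `u` have ends of equal norm, as in a sphere about the
origin, is a rectangle. -/
theorem inner_eq_zero_of_parallelogram {F : Set E} {x u v : E}
    (hF : F = {x} + segment ℝ 0 u + segment ℝ 0 v) (hli : LinearIndependent ℝ ![u, v])
    (hedge : ∀ y z : E, IsExposed ℝ F (segment ℝ y z) → ‖y‖ = ‖z‖) : inner ℝ u v = 0 := by
  -- A positive multiple of the component of `v` orthogonal to `u`; `w` and `-w` expose the two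
  -- sides parallel to `u`.
  set w := (inner ℝ u u) • v - (inner ℝ u v) • u with hw
  have hu0 : u ≠ 0 := hli.ne_zero 0
  have huu : 0 < inner ℝ u u := real_inner_self_pos.2 hu0
  have hwu : inner ℝ w u = 0 := by
    rw [hw, inner_sub_left, real_inner_smul_left, real_inner_smul_left, real_inner_comm u v]
    ring
  have hw0 : w ≠ 0 := by
    intro h
    have h1 := (LinearIndependent.pair_iff.1 hli) (-(inner ℝ u v)) (inner ℝ u u) (by
      rw [← h, hw]; module)
    exact huu.ne' h1.2
  have hwv : 0 < inner ℝ w v := by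
    have h1 : inner ℝ w w = inner ℝ u u * inner ℝ w v := by
      conv_lhs => rw [hw, ← hw, inner_sub_right, real_inner_smul_right, real_inner_smul_right, hwu]
      ring
    have h2 : 0 < inner ℝ w w := real_inner_self_pos.2 hw0
    rw [h1] at h2
    exact (pos_iff_pos_of_mul_pos h2).1 huu
  have hE₁ : IsExposed ℝ F (segment ℝ (x + v) (x + v + u)) := by
    have h1 : (innerSL ℝ w).toExposed F = segment ℝ (x + v) (x + v + u) := by
      rw [hF, toExposed_add, toExposed_add, toExposed_singleton,
        toExposed_segment_of_eq (by simpa using hwu), toExposed_segment_of_pos (by simpa using hwv),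
        add_right_comm, Set.singleton_add_singleton, singleton_add_segment_zero]
    exact h1 ▸ ContinuousLinearMap.toExposed.isExposed
  have hE₂ : IsExposed ℝ F (segment ℝ x (x + u)) := by
    have h1 : (-(innerSL ℝ w)).toExposed F = segment ℝ x (x + u) := by
      rw [hF, toExposed_add, toExposed_add, toExposed_singleton,
        toExposed_segment_of_eq (by simpa using hwu), toExposed_segment_of_neg (by simpa using hwv),
        singleton_add_segment_zero, Set.add_singleton]
      simp
    exact h1 ▸ ContinuousLinearMap.toExposed.isExposed
  have n₁ := congrArg (· ^ 2) (hedge _ _ hE₁)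
  have n₂ := congrArg (· ^ 2) (hedge _ _ hE₂)
  simp only [norm_add_sq_real (x + v) u, norm_add_sq_real x u] at n₁ n₂
  rw [inner_add_left, real_inner_comm u v] at n₁
  linarith

end FacesOfSums

/-! ### A parallelogram face of a zonotope in space. -/

section Rectangle

theorem exists_ne_zero_inner_eq_zero (a b : EuclideanSpace ℝ (Fin 3)) :
    ∃ n : EuclideanSpace ℝ (Fin 3), n ≠ 0 ∧ inner ℝ n a = 0 ∧ inner ℝ n b = 0 := by
  classical
  have hlt : Module.finrank ℝ (Submodule.span ℝ ({a, b} : Set (EuclideanSpace ℝ (Fin 3)))) ≤ 2 := by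
    have := finrank_span_finset_le_card (R := ℝ) ({a, b} : Finset (EuclideanSpace ℝ (Fin 3)))
    simp only [Finset.coe_insert, Finset.coe_singleton] at this
    exact this.trans Finset.card_le_two
  have hadd := Submodule.finrank_add_finrank_orthogonal
    (Submodule.span ℝ ({a, b} : Set (EuclideanSpace ℝ (Fin 3))))
  rw [finrank_euclideanSpace_fin] at hadd
  have hne : (Submodule.span ℝ ({a, b} : Set (EuclideanSpace ℝ (Fin 3))))ᗮ ≠ ⊥ := by
    intro h
    rw [h, finrank_bot] at hadd
    omega
  obtain ⟨n, hn, hn0⟩ := Submodule.exists_mem_ne_zero_of_ne_bot hne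
  refine ⟨n, hn0, ?_, ?_⟩
  · exact Submodule.inner_left_of_mem_orthogonal (Submodule.subset_span (by simp)) hn
  · exact Submodule.inner_left_of_mem_orthogonal (Submodule.subset_span (by simp)) hn

theorem mem_span_pair_of_inner_eq_zero {n p q x : EuclideanSpace ℝ (Fin 3)} (hn : n ≠ 0)
    (hp : inner ℝ n p = 0) (hq : inner ℝ n q = 0) (hli : LinearIndependent ℝ ![p, q])
    (hx : inner ℝ n x = 0) :
    x ∈ Submodule.span ℝ ({p, q} : Set (EuclideanSpace ℝ (Fin 3))) := by
  have : Fact (Module.finrank ℝ (EuclideanSpace ℝ (Fin 3)) = 2 + 1) := ⟨by simp⟩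
  have h := Submodule.finrank_orthogonal_span_singleton (𝕜 := ℝ) (n := 2) hn
  have e : Submodule.span ℝ ({p, q} : Set (EuclideanSpace ℝ (Fin 3))) =
      (Submodule.span ℝ {n})ᗮ := by
    refine Submodule.eq_of_le_of_finrank_eq (Submodule.span_le.2 ?_) ?_
    · rintro w (rfl | rfl)
      · exact Submodule.mem_orthogonal_singleton_iff_inner_right.2 hp
      · exact Submodule.mem_orthogonal_singleton_iff_inner_right.2 hq
    · rw [h, finrank_span_pair_of_linearIndependent hli]
  rw [e]
  exact Submodule.mem_orthogonal_singleton_iff_inner_right.2 hx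

theorem not_const_of_interior_nonempty {E : Type*} [NormedAddCommGroup E] [InnerProductSpace ℝ E]
    {P : Set E} (hP : (interior P).Nonempty) {n : E} (hn : n ≠ 0) :
    ∃ x ∈ P, ∃ y ∈ P, (inner ℝ n x : ℝ) ≠ inner ℝ n y := by
  obtain ⟨x, hx⟩ := hP
  have hc : Filter.Tendsto (fun t : ℝ => x + t • n) (nhdsWithin 0 (Set.Ioi 0)) (nhds x) := by
    have : Continuous fun t : ℝ => x + t • n := by fun_prop
    have h := this.tendsto 0
    simp only [zero_smul, add_zero] at h
    exact h.mono_left nhdsWithin_le_nhds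
  obtain ⟨t, ht, ht0⟩ := ((hc.eventually (mem_interior_iff_mem_nhds.1 hx)).and
    self_mem_nhdsWithin).exists
  refine ⟨x, interior_subset hx, x + t • n, ht, ?_⟩
  have ht0 : 0 < t := ht0
  have : 0 < inner ℝ n n := real_inner_self_pos.2 hn
  rw [inner_add_right, real_inner_smul_right]
  have := mul_pos ht0 this
  linarith

/-- A zonotope with nonempty interior in space has a face that is a parallelogram. -/
theorem exists_parallelogram_face {k : ℕ} {a b : Fin k → EuclideanSpace ℝ (Fin 3)}
    (hint : (interior (∑ i, segment ℝ (a i) (b i))).Nonempty) :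
    ∃ (l : StrongDual ℝ (EuclideanSpace ℝ (Fin 3))) (x u v : EuclideanSpace ℝ (Fin 3)),
      LinearIndependent ℝ ![u, v] ∧
      l.toExposed (∑ i, segment ℝ (a i) (b i)) = {x} + segment ℝ 0 u + segment ℝ 0 v := by
  classical
  -- The plane `f = 1` is an affine chart for directions: parallel segments give the same point `ξ
  -- i`.
  obtain ⟨f, hf⟩ := Module.exists_dual_forall_apply_ne_zero (K := ℝ)
    (fun i : {i : Fin k // b i - a i ≠ 0} => b i - a i) (fun i => i.2)
  replace hf : ∀ i, b i - a i ≠ 0 → f (b i - a i) ≠ 0 := fun i hi => hf ⟨i, hi⟩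
  set ξ : Fin k → EuclideanSpace ℝ (Fin 3) := fun i => (f (b i - a i))⁻¹ • (b i - a i) with hξ
  set S := (Finset.univ.filter fun i => b i - a i ≠ 0).image ξ with hS
  have hξS : ∀ i, b i - a i ≠ 0 → ξ i ∈ S := fun i hi =>
    Finset.mem_image_of_mem _ (by simpa using hi)
  have hdξ : ∀ i, b i - a i ≠ 0 → b i - a i = f (b i - a i) • ξ i := fun i hi => by
    simp only [hξ]
    rw [smul_smul, mul_inv_cancel₀ (hf i hi), one_smul]
  have hfS : ∀ x ∈ S, f x = 1 := by
    intro x hx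
    obtain ⟨i, hi, rfl⟩ := Finset.mem_image.1 hx
    simp only [Finset.mem_filter, Finset.mem_univ, true_and] at hi
    simp only [hξ, map_smul, smul_eq_mul]
    exact inv_mul_cancel₀ (hf i hi)
  have hspan : ∀ p q : EuclideanSpace ℝ (Fin 3),
      ¬ ∀ x ∈ S, x ∈ Submodule.span ℝ ({p, q} : Set (EuclideanSpace ℝ (Fin 3))) := by
    intro p q h
    obtain ⟨n, hn, hnp, hnq⟩ := exists_ne_zero_inner_eq_zero p q
    obtain ⟨x, hx, y, hy, hxy⟩ := not_const_of_interior_nonempty hint hn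
    have hd : ∀ i, inner ℝ n (b i - a i) = 0 := by
      intro i
      by_cases hi : b i - a i = 0
      · rw [hi, inner_zero_right]
      · obtain ⟨s, t, hst⟩ := Submodule.mem_span_pair.1 (h _ (hξS i hi))
        rw [hdξ i hi, ← hst]
        simp only [inner_add_right, real_inner_smul_right, hnp, hnq]
        ring
    have hface : (innerSL ℝ n).toExposed (∑ i, segment ℝ (a i) (b i))
        = ∑ i, segment ℝ (a i) (b i) := by
      rw [toExposed_sum]
      exact Finset.sum_congr rfl fun i _ => toExposed_segment_of_eq (hd i)
    rw [← hface] at hx hy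
    exact hxy (le_antisymm (hy.2 x hx.1) (hx.2 y hy.1))
  have hncol : ∃ p ∈ S, ∃ q ∈ S, ∃ r ∈ S, 0 < triangleGram p q r := by
    by_contra! hcon
    by_cases hpq : ∃ p ∈ S, ∃ q ∈ S, p ≠ q
    · obtain ⟨p, hp, q, hq, hpq⟩ := hpq
      refine hspan p q fun r hr => ?_
      rw [eq_add_smul_of_triangleGram_nonpos hpq (hcon p hp q hq r hr)]
      exact Submodule.mem_span_pair.2
        ⟨1 - (inner ℝ (q - p) (r - p) / inner ℝ (q - p) (q - p)),
          inner ℝ (q - p) (r - p) / inner ℝ (q - p) (q - p), by module⟩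
    · push Not at hpq
      rcases S.eq_empty_or_nonempty with h | ⟨p, hp⟩
      · exact hspan 0 0 (by simp [h])
      · refine hspan p p fun r hr => ?_
        rw [hpq r hr p hp]
        exact Submodule.subset_span (by simp)
  -- An ordinary line of the chart spans a plane containing exactly two segment directions; the face
  -- with normal `n` orthogonal to it is the parallelogram.
  obtain ⟨p, hp, q, hq, hpq, hord⟩ := exists_ordinary_line hncol
  have hli : LinearIndependent ℝ ![p, q] := by
    refine LinearIndependent.pair_iff.2 fun s t hst => ?_
    have h1 := congrArg f hst
    simp only [map_add, map_smul, smul_eq_mul, hfS p hp, hfS q hq, mul_one, map_zero] at h1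
    have hs : s = -t := by linarith
    have h2 : t • (q - p) = 0 := by rw [← hst, hs]; module
    have h3 : t = 0 := (smul_eq_zero.1 h2).resolve_right (sub_ne_zero.2 hpq.symm)
    exact ⟨by rw [hs, h3, neg_zero], h3⟩
  obtain ⟨n, hn, hnp, hnq⟩ := exists_ne_zero_inner_eq_zero p q
  have hdir : ∀ i, b i - a i ≠ 0 → inner ℝ n (b i - a i) = 0 → ξ i = p ∨ ξ i = q := by
    intro i hi hni
    have h1 : inner ℝ n (ξ i) = 0 := by
      simp only [hξ, real_inner_smul_right, hni, mul_zero]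
    obtain ⟨s, t, hst⟩ := Submodule.mem_span_pair.1
      (mem_span_pair_of_inner_eq_zero hn hnp hnq hli h1)
    have h2 := hfS _ (hξS i hi)
    rw [← hst] at h2
    simp only [map_add, map_smul, smul_eq_mul, hfS p hp, hfS q hq, mul_one] at h2
    have h3 : ξ i = p + t • (q - p) := by
      rw [← hst, show s = 1 - t by linarith]; module
    rcases hord t (h3 ▸ hξS i hi) with h | h
    · left; rw [h3, h]; simp
    · right; rw [h3, h]; simp
  have hpiece : ∀ i, ∃ (x : EuclideanSpace ℝ (Fin 3)) (α β : ℝ), 0 ≤ α ∧ 0 ≤ β ∧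
      (b i - a i ≠ 0 → ξ i = p → 0 < α) ∧ (b i - a i ≠ 0 → ξ i = q → 0 < β) ∧
      (innerSL ℝ n).toExposed (segment ℝ (a i) (b i)) =
        {x} + α • segment ℝ 0 p + β • segment ℝ 0 q := by
    intro i
    have zero_smul_seg : ∀ w : EuclideanSpace ℝ (Fin 3), (0 : ℝ) • segment ℝ 0 w = 0 := fun w =>
      Set.zero_smul_set ⟨0, left_mem_segment ℝ 0 w⟩
    have hseg : ∀ w : EuclideanSpace ℝ (Fin 3), ξ i = w → b i - a i ≠ 0 →
        ∃ (x : EuclideanSpace ℝ (Fin 3)) (α : ℝ), 0 < α ∧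
        segment ℝ (a i) (b i) = {x} + α • segment ℝ 0 w := by
      intro w hw hi
      have hd := hdξ i hi
      rw [hw] at hd
      rcases (hf i hi).lt_or_gt with h | h
      · refine ⟨b i, -f (b i - a i), by linarith, ?_⟩
        rw [smul_segment_zero, singleton_add_segment_zero, neg_smul, ← hd, segment_symm]
        congr 1; abel
      · refine ⟨a i, f (b i - a i), h, ?_⟩
        rw [smul_segment_zero, singleton_add_segment_zero, ← hd]
        congr 1; abel
    have hnw : ∀ w : EuclideanSpace ℝ (Fin 3), ξ i = w → b i - a i ≠ 0 → inner ℝ n w = 0 →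
        inner ℝ n (b i - a i) = 0 := by
      intro w hw hi h
      rw [hdξ i hi, hw, real_inner_smul_right, h, mul_zero]
    by_cases hi : b i - a i = 0
    · refine ⟨a i, 0, 0, le_rfl, le_rfl, fun h => absurd hi h, fun h => absurd hi h, ?_⟩
      rw [zero_smul_seg, zero_smul_seg, add_zero, add_zero, sub_eq_zero.1 hi, segment_same,
        toExposed_singleton]
    · rcases lt_trichotomy (inner ℝ n (b i - a i)) 0 with h | h | h
      · refine ⟨a i, 0, 0, le_rfl, le_rfl, fun _ hw => absurd (hnw p hw hi hnp) h.ne,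
          fun _ hw => absurd (hnw q hw hi hnq) h.ne, ?_⟩
        rw [zero_smul_seg, zero_smul_seg, add_zero, add_zero,
          toExposed_segment_of_neg (by simpa using h)]
      · rw [toExposed_segment_of_eq (by simpa using h)]
        rcases hdir i hi h with hw | hw
        · obtain ⟨x, α, hα, e⟩ := hseg p hw hi
          refine ⟨x, α, 0, hα.le, le_rfl, fun _ _ => hα, fun _ hw' => ?_, ?_⟩
          · exact absurd (hw.symm.trans hw') hpq
          · rw [zero_smul_seg, add_zero, e]
        · obtain ⟨x, α, hα, e⟩ := hseg q hw hi
          refine ⟨x, 0, α, le_rfl, hα.le, fun _ hw' => ?_, fun _ _ => hα, ?_⟩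
          · exact absurd (hw'.symm.trans hw) hpq
          · rw [zero_smul_seg, add_zero, e]
      · refine ⟨b i, 0, 0, le_rfl, le_rfl, fun _ hw => absurd (hnw p hw hi hnp) h.ne',
          fun _ hw => absurd (hnw q hw hi hnq) h.ne', ?_⟩
        rw [zero_smul_seg, zero_smul_seg, add_zero, add_zero,
          toExposed_segment_of_pos (by simpa using h)]
  choose x α β hα hβ hαp hβq hface using hpiece
  have hsum : ∀ (γ : Fin k → ℝ) (w : EuclideanSpace ℝ (Fin 3)) (s : Finset (Fin k)),
      (∀ i, 0 ≤ γ i) →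
      ∑ i ∈ s, γ i • segment ℝ 0 w = (∑ i ∈ s, γ i) • segment ℝ 0 w := by
    intro γ w s hγ
    induction s using Finset.induction_on with
    | empty =>
      rw [Finset.sum_empty, Finset.sum_empty, Set.zero_smul_set ⟨0, left_mem_segment ℝ 0 w⟩]
    | insert i s hi ih =>
      rw [Finset.sum_insert hi, Finset.sum_insert hi, ih,
        (convex_segment 0 w).add_smul (hγ i) (Finset.sum_nonneg fun i _ => hγ i)]
  have hpos : ∀ (γ : Fin k → ℝ) (w : EuclideanSpace ℝ (Fin 3)), w ∈ S → (∀ i, 0 ≤ γ i) →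
      (∀ i, b i - a i ≠ 0 → ξ i = w → 0 < γ i) → 0 < ∑ i, γ i := by
    intro γ w hw hγ h
    obtain ⟨i, hi, hiw⟩ := Finset.mem_image.1 hw
    simp only [Finset.mem_filter, Finset.mem_univ, true_and] at hi
    exact Finset.sum_pos' (fun i _ => hγ i) ⟨i, Finset.mem_univ i, h i hi hiw⟩
  have hA := hpos α p hp hα hαp
  have hB := hpos β q hq hβ hβq
  refine ⟨innerSL ℝ n, ∑ i, x i, (∑ i, α i) • p, (∑ i, β i) • q, ?_, ?_⟩
  · refine LinearIndependent.pair_iff.2 fun s t hst => ?_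
    rw [smul_smul, smul_smul] at hst
    obtain ⟨h1, h2⟩ := LinearIndependent.pair_iff.1 hli _ _ hst
    exact ⟨(mul_eq_zero.1 h1).resolve_right hA.ne', (mul_eq_zero.1 h2).resolve_right hB.ne'⟩
  · rw [toExposed_sum, Finset.sum_congr rfl fun i _ => hface i, Finset.sum_add_distrib,
      Finset.sum_add_distrib, hsum α p _ hα, hsum β q _ hβ, smul_segment_zero, smul_segment_zero]
    congr 2
    exact (map_sum (Set.singletonAddMonoidHom) x Finset.univ).symm

end Rectangle

/-! ### The regular octahedron as counterexample. -/

section Octahedron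

/-- The vertices of the regular octahedron. -/
noncomputable def octahedronVertices : Finset (EuclideanSpace ℝ (Fin 3)) :=
  open Classical in Finset.univ.image (fun i : Fin 3 => EuclideanSpace.single i (1 : ℝ)) ∪
    Finset.univ.image (fun i : Fin 3 => -EuclideanSpace.single i (1 : ℝ))

/-- The regular octahedron. -/
noncomputable def octahedron : Set (EuclideanSpace ℝ (Fin 3)) :=
  convexHull ℝ (octahedronVertices : Set (EuclideanSpace ℝ (Fin 3)))

theorem mem_octahedronVertices {v : EuclideanSpace ℝ (Fin 3)} :
    v ∈ octahedronVertices ↔ ∃ i : Fin 3,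
      v = EuclideanSpace.single i (1 : ℝ) ∨ v = -EuclideanSpace.single i (1 : ℝ) := by
  simp only [octahedronVertices, Finset.mem_union, Finset.mem_image, Finset.mem_univ, true_and,
    exists_or, eq_comm]

theorem single_mem_octahedron (i : Fin 3) : EuclideanSpace.single i (1 : ℝ) ∈ octahedron :=
  subset_convexHull ℝ _ (mem_octahedronVertices.2 ⟨i, Or.inl rfl⟩)

theorem isOSymmetricPolytope_octahedron : IsOSymmetricPolytope octahedron := by
  refine ⟨⟨octahedronVertices.finite_toSet.isCompact_convexHull ℝ, convex_convexHull ℝ _, ?_⟩,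
    ?_, ⟨octahedronVertices, rfl⟩⟩
  · have hv : ∀ i : Fin 3, EuclideanSpace.single i (1 : ℝ) ∈ octahedronVertices := fun i =>
      mem_octahedronVertices.2 ⟨i, Or.inl rfl⟩
    rw [octahedron, interior_convexHull_nonempty_iff_affineSpan_eq_top,
      AffineSubspace.affineSpan_eq_top_iff_vectorSpan_eq_top_of_nonempty _ _ _ ⟨_, hv 0⟩,
      eq_top_iff, ← (EuclideanSpace.basisFun (Fin 3) ℝ).toBasis.span_eq, Submodule.span_le]
    rintro _ ⟨i, rfl⟩
    have h := vsub_mem_vectorSpan ℝ (Finset.mem_coe.2 (hv i))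
      (Finset.mem_coe.2 (mem_octahedronVertices.2 ⟨i, Or.inr rfl⟩))
    have h2 := Submodule.smul_mem _ (1 / 2 : ℝ) h
    simp only [OrthonormalBasis.coe_toBasis, EuclideanSpace.basisFun_apply, SetLike.mem_coe]
    convert h2 using 1
    rw [vsub_eq_sub]
    module
  · intro x hx
    have h : octahedron ⊆ -octahedron := by
      refine convexHull_min (fun v hv => ?_) (convex_convexHull ℝ _).neg
      refine Set.mem_neg.2 (subset_convexHull ℝ _ ?_)
      obtain ⟨i, rfl | rfl⟩ := mem_octahedronVertices.1 hv
      · exact mem_octahedronVertices.2 ⟨i, Or.inr rfl⟩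
      · exact mem_octahedronVertices.2 ⟨i, Or.inl (neg_neg _)⟩
    exact h hx

theorem isInscribedInSphere_octahedron : IsInscribedInSphere octahedron := by
  refine ⟨0, 1, one_pos, fun v hv => ?_⟩
  obtain ⟨i, rfl | rfl⟩ := mem_octahedronVertices.1 (extremePoints_convexHull_subset hv) <;> simp

theorem inner_le_of_mem_octahedron {w x : EuclideanSpace ℝ (Fin 3)} (hw : ∀ i, |w i| ≤ 1)
    (hx : x ∈ octahedron) : inner ℝ w x ≤ 1 := by
  refine le_of_mem_convexHull (l := innerSL ℝ w) (fun v hv => ?_) hx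
  obtain ⟨i, rfl | rfl⟩ := mem_octahedronVertices.1 hv
  · have := (abs_le.1 (hw i)).2
    simpa [EuclideanSpace.inner_single_right] using this
  · have := (abs_le.1 (hw i)).1
    simp only [innerSL_apply_apply, inner_neg_right, EuclideanSpace.inner_single_right]
    simp
    linarith

theorem meanNormals_octahedron_ne : meanNormals octahedron ≠ 3 ^ 3 - 1 := by
  intro h
  have hP := isOSymmetricPolytope_octahedron
  obtain ⟨π, hπ⟩ := exists_isMetricProjection hP.isConvexBody.isCompact hP.isConvexBody.convex
    (hP.isConvexBody.interior_nonempty.mono interior_subset)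
  set e : Fin 3 → EuclideanSpace ℝ (Fin 3) := fun i => EuclideanSpace.single i (1 : ℝ) with he
  -- Chosen so that its triple lies on the normal ray from the vertex `e 0` in direction `(1, 1,
  -- 1)`. Reflection in `e 0` gives `(1/3, -2/3, -2/3)`, outside since its coordinates have absolute
  -- sum 5/3.
  have hy : (5 / 9 : ℝ) • e 0 + (4 / 9 : ℝ) • ((1 / 2 : ℝ) • e 1 + (1 / 2 : ℝ) • e 2)
      ∈ octahedron := by
    have hc := hP.isConvexBody.convex
    exact hc (single_mem_octahedron 0) (hc (single_mem_octahedron 1) (single_mem_octahedron 2)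
      (by norm_num) (by norm_num) (by norm_num)) (by norm_num) (by norm_num) (by norm_num)
  have e3 : (3 : ℝ) • ((5 / 9 : ℝ) • e 0 + (4 / 9 : ℝ) • ((1 / 2 : ℝ) • e 1 + (1 / 2 : ℝ) • e 2))
      = e 0 + (2 / 3 : ℝ) • !₂[1, 1, 1] := by
    ext i
    fin_cases i <;> simp [he] <;> norm_num
  have hmem := reflection_mem_of_meanNormals_eq hπ hP h hy
  have hproj : π (e 0 + (2 / 3 : ℝ) • !₂[1, 1, 1]) = e 0 := by
    refine hπ.eq_of_inner_le (single_mem_octahedron 0) fun w hw => ?_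
    rw [add_sub_cancel_left, real_inner_smul_left, inner_sub_right]
    have h1 : inner ℝ (!₂[1, 1, 1] : EuclideanSpace ℝ (Fin 3)) w ≤ 1 :=
      inner_le_of_mem_octahedron (by intro i; fin_cases i <;> simp) hw
    have h2 : inner ℝ (!₂[1, 1, 1] : EuclideanSpace ℝ (Fin 3)) (e 0) = 1 := by
      simp [he, EuclideanSpace.inner_single_right]
    linarith
  rw [e3, hproj] at hmem
  have h1 := inner_le_of_mem_octahedron (w := !₂[1, -1, -1])
    (by intro i; fin_cases i <;> simp) hmem
  have e4 : (2 : ℝ) • e 0 - (e 0 + (2 / 3 : ℝ) • !₂[1, 1, 1]) =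
      (!₂[1 / 3, -2 / 3, -2 / 3] : EuclideanSpace ℝ (Fin 3)) := by
    ext i
    fin_cases i <;> simp [he] <;> norm_num
  rw [e4] at h1
  simp [PiLp.inner_apply, Fin.sum_univ_three] at h1
  norm_num at h1

end Octahedron

/-! ### Assembly of the results. -/

theorem isZonotope_of_meanNormals_eq {m : ℕ} {P : Set (EuclideanSpace ℝ (Fin m))}
    (hP : IsOSymmetricPolytope P) (h : meanNormals P = 3 ^ m - 1) : IsZonotope P := by
  have hne : P.Nonempty := hP.isConvexBody.interior_nonempty.mono interior_subset
  obtain ⟨π, hπ⟩ := exists_isMetricProjection hP.isConvexBody.isCompact hP.isConvexBody.convex hne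
  have hr := fun x (hx : x ∈ P) => reflection_mem_of_meanNormals_eq hπ hP h hx
  obtain ⟨V, rfl⟩ := hP.isConvexPolytope
  have hV : V.Nonempty := by
    rw [convexHull_nonempty_iff] at hne
    exact hne
  refine HasSymmetricFaces.exists_eq_sum_segment _ V rfl hV fun l => ?_
  have hexp : IsExposed ℝ (convexHull ℝ (V : Set _)) (l.toExposed (convexHull ℝ (V : Set _))) :=
    ContinuousLinearMap.toExposed.isExposed
  have hFne : (l.toExposed (convexHull ℝ (V : Set (EuclideanSpace ℝ (Fin m))))).Nonempty := by
    rw [toExposed_convexHull, convexHull_nonempty_iff]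
    exact maxFilter_nonempty hV l
  obtain ⟨c, -, -, hc⟩ := hπ.exists_center hP.isOSymmetric hr hexp.isExtreme
    (hexp.convex hP.isConvexBody.convex) (hexp.isCompact hP.isConvexBody.isCompact) hFne
  exact ⟨(2 : ℝ) • c, hc⟩

theorem exists_rectangle_face_of_meanNormals_eq {P : Set (EuclideanSpace ℝ (Fin 3))}
    (hP : IsOSymmetricPolytope P) (h : meanNormals P = 3 ^ 3 - 1) :
    ∃ F, IsFaceOfDim P 2 F ∧ IsRectangle F := by
  obtain ⟨π, hπ⟩ := exists_isMetricProjection hP.isConvexBody.isCompact hP.isConvexBody.convex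
    (hP.isConvexBody.interior_nonempty.mono interior_subset)
  have hr := fun x (hx : x ∈ P) => reflection_mem_of_meanNormals_eq hπ hP h hx
  obtain ⟨k, a, b, hk⟩ := isZonotope_of_meanNormals_eq hP h
  obtain ⟨l, x, u, v, hli, hF⟩ := exists_parallelogram_face
    (hk ▸ hP.isConvexBody.interior_nonempty)
  rw [← hk] at hF
  have hexp : IsExposed ℝ P (l.toExposed P) := ContinuousLinearMap.toExposed.isExposed
  refine ⟨l.toExposed P, ⟨?_, hexp, ?_⟩, x, u, v, hli.ne_zero 0, hli.ne_zero 1, ?_, ?_⟩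
  · rw [hF, parallelogram_eq_convexHull]
    exact ⟨x, subset_convexHull ℝ _ (by simp)⟩
  · rw [hF, finrank_vectorSpan_parallelogram hli]
  · exact inner_eq_zero_of_parallelogram hF hli fun y z hyz =>
      norm_eq_of_isExtreme_segment hπ hP.isOSymmetric hr (hexp.isExtreme.trans hyz.isExtreme)
  · rw [hF, parallelogram_eq_convexHull]

theorem pi_div_two_le_of_mem_polygonAngles {m : ℕ} {P F : Set (EuclideanSpace ℝ (Fin m))}
    (hP : IsOSymmetricPolytope P) (h : meanNormals P = 3 ^ m - 1) (hF : IsFaceOfDim P 2 F) {θ : ℝ}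
    (hθ : θ ∈ polygonAngles F) : Real.pi / 2 ≤ θ := by
  obtain ⟨π, hπ⟩ := exists_isMetricProjection hP.isConvexBody.isCompact hP.isConvexBody.convex
    (hP.isConvexBody.interior_nonempty.mono interior_subset)
  have hr := fun x (hx : x ∈ P) => reflection_mem_of_meanNormals_eq hπ hP h hx
  obtain ⟨x, y, z, hy, hz, hyz, rfl⟩ := hθ
  have hle := inner_nonpos_of_edges hπ hP.isOSymmetric hr hF.2.1.isExtreme
    (hF.2.1.convex hP.isConvexBody.convex) (hF.2.1.isCompact hP.isConvexBody.isCompact) hF.2.2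
    hy.2.1 hz.2.1 hyz
  rw [EuclideanGeometry.angle, InnerProductGeometry.angle, ← Real.arccos_zero]
  exact Real.arccos_le_arccos (div_nonpos_of_nonpos_of_nonneg hle (by positivity))

theorem theorem2 :
    (∀ (m : ℕ) (P : Set (EuclideanSpace ℝ (Fin m))),
      IsOSymmetricPolytope P → meanNormals P = 3 ^ m - 1 → IsZonotope P) ∧
    (∀ P : Set (EuclideanSpace ℝ (Fin 3)),
      IsOSymmetricPolytope P → meanNormals P = 3 ^ 3 - 1 →
        (∀ F, IsFaceOfDim P 2 F → ∀ θ ∈ polygonAngles F, Real.pi / 2 ≤ θ) ∧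
        ∃ F, IsFaceOfDim P 2 F ∧ IsRectangle F) ∧
    (∃ P : Set (EuclideanSpace ℝ (Fin 3)),
      IsOSymmetricPolytope P ∧ IsInscribedInSphere P ∧ meanNormals P ≠ 3 ^ 3 - 1) :=
  ⟨fun _ _ hP h => isZonotope_of_meanNormals_eq hP h,
    fun _ hP h => ⟨fun _ hF _ hθ => pi_div_two_le_of_mem_polygonAngles hP h hF hθ,
      exists_rectangle_face_of_meanNormals_eq hP h⟩,
    octahedron, isOSymmetricPolytope_octahedron, isInscribedInSphere_octahedron,
    meanNormals_octahedron_ne⟩
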